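/- Let $d\ge 1$ be an integer, let $0<s<d$, and let $\Lambda\subset\mathbb{R}^d$ be a (full-rank) lattice with co-volume $|\Lambda|$ and dual lattice $\Lambda^*=\{x\in\mathbb{R}^d:\langle x,\lambda\rangle\in\mathbb{Z}\ \text{for all}\ \lambda\in\Lambda\}$. Let $\omega_{d-1}=d\,\pi^{d/2}/\Gamma\left(\frac d2+1\right)$ be the surface measure of the unit sphere of $\mathbb{R}^d$, and let $$\mathcal{D}=B(0,r_d)\quad\text{with}\quad r_d=\left(\frac{d\,|\Lambda|^{-1}}{\omega_{d-1}}\right)^{1/d}.$$ Let $\nu$ be the multiple of Lebesgue measure on $\mathbb{R}^d$ that gives mass $1$ to a fundamental domain of $\Lambda^*$, and put $$I_\nu^{\mathcal D}(t)=\int_{\mathcal{D}\times\mathcal{D}}\frac{d\nu(x)\,d\nu(y)}{|x-y|^{t}},\qquad 0<t<d.$$ Let $J_\alpha$ be the Bessel function of the first kind of order $\alpha$, and let ${}_2F_1$ be the Gauss hypergeometric function. Then $|\mathcal{D}||\Lambda|=1$, the integral $I_\nu^{\mathcal D}(d-s)$ and the integral $\int_0^\infty J_{d/2}(t)^2\,t^{-1-s}\,dt$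 are finite, the series of ${}_2F_1\left(\frac{d-s}{2},\frac{d+1}{2};d+1;\cdot\right)$ converges at $1$, and $$\frac{\pi^{s-\frac d2}\,\Gamma\left(\frac{d-s}{2}\right)}{\Gamma\left(\frac s2\right)|\Lambda|^{1-\frac sd}}\;I_\nu^{\mathcal D}(d-s)=d\left[2\pi\left(\frac{d}{\omega_{d-1}}\right)^{1/d}\right]^s\int_0^\infty\frac{J_{d/2}(t)^2}{t^{1+s}}\,dt,$$ where $$\int_0^\infty\frac{J_{d/2}(t)^2}{t^{1+s}}\,dt=\frac{\Gamma\left(\frac{d-s}{2}\right)}{2^{d+1}\,\Gamma\left(\frac d2+1\right)\Gamma\left(\frac s2+1\right)}\;{}_2F_1\left(\frac{d-s}{2},\frac{d+1}{2};d+1;1\right)$$ $$=\frac{\Gamma\left(\frac{d-s}{2}\right)\Gamma(d+1)\,\Gamma\left(\frac{s+1}{2}\right)}{2^{d+1}\,\Gamma\left(\frac d2+1\right)\Gamma\left(\frac s2+1\right)\Gamma\left(\frac{d+s}{2}+1\right)\Gamma\left(\frac{d+1}{2}\right)}.$$ -/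

import Mathlib

open MeasureTheory Set

noncomputable section

namespace RieszTorus

/-- The dual lattice `Λ* = {x ∈ ℝ^d : ⟨x, v⟩ ∈ ℤ for all v ∈ Λ}`. -/
def dualLattice {d : ℕ} (Λ : Submodule ℤ (EuclideanSpace ℝ (Fin d))) :
    Submodule ℤ (EuclideanSpace ℝ (Fin d)) where
  carrier := {x | ∀ v ∈ Λ, ∃ n : ℤ, inner ℝ x v = (n : ℝ)}
  add_mem' := by
    intro x y hx hy v hv
    obtain ⟨m, hm⟩ := hx v hv
    obtain ⟨n, hn⟩ := hy v hv
    exact ⟨m + n, by rw [inner_add_left, hm, hn]; push_cast; rfl⟩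
  zero_mem' := by
    intro v _
    exact ⟨0, by simp⟩
  smul_mem' := by
    intro c x hx v hv
    obtain ⟨m, hm⟩ := hx v hv
    refine ⟨c * m, ?_⟩
    rw [← Int.cast_smul_eq_zsmul ℝ c x, real_inner_smul_left, hm]
    push_cast
    rfl

/-- The multiple `ν` of Lebesgue measure on `ℝ^d` that gives mass `1` to a fundamental domain of
the dual lattice `Λ*` (see `nu_fundamentalDomain`). -/
def nu {d : ℕ} (Λ : Submodule ℤ (EuclideanSpace ℝ (Fin d))) :
    Measure (EuclideanSpace ℝ (Fin d)) :=
  (ENNReal.ofReal (ZLattice.covolume (dualLattice Λ) volume))⁻¹ • volume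

theorem exists_basis_dualLattice {d : ℕ} (Λ : Submodule ℤ (EuclideanSpace ℝ (Fin d)))
    [DiscreteTopology Λ] [IsZLattice ℝ Λ] :
    ∃ b : Module.Basis (Module.Free.ChooseBasisIndex ℤ Λ) ℝ (EuclideanSpace ℝ (Fin d)),
      dualLattice Λ = Submodule.span ℤ (Set.range b) := by
  classical
  let B : LinearMap.BilinForm ℝ (EuclideanSpace ℝ (Fin d)) := innerₗ _
  have hB : B.Nondegenerate := by
    constructor
    · intro x hx
      exact inner_self_eq_zero.mp (hx x)
    · intro x hx
      exact inner_self_eq_zero.mp (hx x)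
  let b := (Module.Free.chooseBasis ℤ Λ).ofZLatticeBasis ℝ
  refine ⟨B.dualBasis hB b, ?_⟩
  rw [← LinearMap.BilinForm.dualSubmodule_span_of_basis B hB b,
    (Module.Free.chooseBasis ℤ Λ).ofZLatticeBasis_span ℝ]
  ext x
  rw [LinearMap.BilinForm.mem_dualSubmodule]
  refine forall₂_congr fun v _ => ?_
  rw [Submodule.mem_one]
  exact exists_congr fun n => eq_comm

/-- The normalization that characterizes `nu Λ` among the multiples of Lebesgue measure. -/
theorem nu_fundamentalDomain {d : ℕ} (Λ : Submodule ℤ (EuclideanSpace ℝ (Fin d)))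
    [DiscreteTopology Λ] [IsZLattice ℝ Λ] {F : Set (EuclideanSpace ℝ (Fin d))}
    (hF : IsAddFundamentalDomain (dualLattice Λ) F volume) : nu Λ F = 1 := by
  obtain ⟨b, hb⟩ := exists_basis_dualLattice Λ
  have : DiscreteTopology (dualLattice Λ) := by rw [hb]; infer_instance
  have : IsZLattice ℝ (dualLattice Λ) :=
    ⟨by rw [hb, Submodule.span_span_of_tower]; exact b.span_eq⟩
  have h := ZLattice.covolume_eq_measure_fundamentalDomain (dualLattice Λ) volume hF
  have hpos := ZLattice.covolume_pos (dualLattice Λ) volume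
  rw [h, measureReal_def] at hpos
  obtain ⟨h0, h1⟩ := ENNReal.toReal_pos_iff.mp hpos
  rw [nu, h, measureReal_def, ENNReal.ofReal_toReal h1.ne, Measure.smul_apply, smul_eq_mul]
  exact ENNReal.inv_mul_cancel h0.ne' h1.ne

/-- The Riesz potential `I_ν^D(t) = ∫_{D × D} |x - y|^{-t} dν(x) dν(y)`. -/
def rieszPotential {d : ℕ} (ν : Measure (EuclideanSpace ℝ (Fin d)))
    (D : Set (EuclideanSpace ℝ (Fin d))) (t : ℝ) : ℝ :=
  ∫ p in D ×ˢ D, 1 / ‖p.1 - p.2‖ ^ t ∂(ν.prod ν)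

/-- `ω_{d-1} = d π^{d/2} / Γ(d/2 + 1)`, the surface measure of the unit sphere of `ℝ^d`
(see `sphereArea_eq_toSphere`). -/
def sphereArea (d : ℕ) : ℝ :=
  d * (Real.pi ^ ((d : ℝ) / 2) / Real.Gamma ((d : ℝ) / 2 + 1))

theorem sphereArea_eq_toSphere (d : ℕ) [Nonempty (Fin d)] :
    sphereArea d =
      (volume : Measure (EuclideanSpace ℝ (Fin d))).toSphere.real Set.univ := by
  rw [Measure.toSphere_real_apply_univ, measureReal_def, EuclideanSpace.volume_ball]
  have h : Real.sqrt Real.pi ^ d = Real.pi ^ ((d : ℝ) / 2) := by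
    rw [Real.sqrt_eq_rpow, ← Real.rpow_natCast, ← Real.rpow_mul Real.pi_pos.le]
    congr 1
    ring
  have h' : (0 : ℝ) ≤ Real.pi ^ ((d : ℝ) / 2) / Real.Gamma ((d : ℝ) / 2 + 1) :=
    div_nonneg (Real.rpow_nonneg Real.pi_pos.le _)
      (Real.Gamma_pos_of_pos (by positivity)).le
  simp [sphereArea, h, ENNReal.toReal_ofReal h']

/-- The Bessel function of the first kind `J_α(x)`, for real order `α` and `x ≥ 0`, by its
(everywhere convergent) power series. -/
def besselJ (α x : ℝ) : ℝ :=
  ∑' k : ℕ, (-1 : ℝ) ^ k / ((Nat.factorial k : ℝ) * Real.Gamma (k + α + 1)) *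
    (x / 2) ^ (2 * (k : ℝ) + α)

end RieszTorus

end

namespace RieszTorus

open ProbabilityTheory (beta beta_pos)
open scoped ENNReal

/-! ### Euler integrals as lower Lebesgue integrals -/

/-! Every quantity has a closed form in Gamma functions, and the identities follow by comparing
closed forms. The analysis is done with lower Lebesgue integrals of nonnegative functions: Tonelli
then needs no integrability check, and a finite value gives convergence at the same time.

Bessel integral (`lintegral_besselJ_sq`). The power series of `J_ν²` cannot be integrated termwise
against `t^(-1-s)`, since no single power of `t` is integrable on the half-line. So `t^(-1-s)` is
written as `t^(2ν+1)` times a superposition of Gaussians `exp(-t²/y)`. Against a Gaussian, termwise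
integration is absolutely convergent, and the resulting series in `y` is that of the Laplace
transform of a Beta density (`lintegral_besselJ_sq_mul_exp`). The alternating signs have
disappeared, so the remaining integrals over `y` and over the Beta variable can be exchanged and are
Euler integrals.

Riesz energy (`lintegral_ball_riesz`). In the variable `z = x - y` the energy is the integral of
`‖z‖^(s-d)` against the volume of the intersection of the ball with its translate by `-z`. Slicing
this lens orthogonally to `z` (`volume_lens`) and passing to polar coordinates leaves a double
integral over a height and a radius; doing the radius first leaves a Beta integral.

Gauss's theorem (`hasSum_ordinaryHypergeometricCoefficient`). Euler's Beta integral represents the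
coefficients and the binomial series sums them under the integral sign.

The lattice enters only through its covolume: the dual lattice has the inverse covolume
(`covolume_dualLattice`), so the energy for `ν` is `|Λ|²` times the Lebesgue energy. Legendre's
duplication formula reconciles the Gamma factors. -/

theorem lintegral_comp_rpow_Ioi (g : ℝ → ℝ≥0∞) {p : ℝ} (hp : p ≠ 0) :
    ∫⁻ x in Ioi 0, ENNReal.ofReal (|p| * x ^ (p - 1)) * g (x ^ p) = ∫⁻ y in Ioi 0, g y := by
  have a : (· ^ p) '' (Ioi 0) = Ioi (0 : ℝ) := by
    ext1 x
    rw [mem_image]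
    constructor
    · rintro ⟨y, hy, rfl⟩
      exact Real.rpow_pos_of_pos hy p
    · exact fun hx ↦ ⟨x ^ (1 / p), Real.rpow_pos_of_pos hx _, by
        simp [← Real.rpow_mul (le_of_lt hx), hp]⟩
  have := lintegral_image_eq_lintegral_abs_deriv_mul measurableSet_Ioi
    (fun x hx ↦ (Real.hasDerivAt_rpow_const (p := p)
      (Or.inl (mem_Ioi.mp hx).ne')).hasDerivWithinAt)
    ((Real.rpow_left_injOn hp).mono (by grind)) g
  rw [a] at this
  rw [this]
  refine setLIntegral_congr_fun measurableSet_Ioi (fun x hx ↦ ?_)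
  simp only [abs_mul, abs_of_nonneg (Real.rpow_nonneg (le_of_lt (mem_Ioi.mp hx)) _)]

/-- This is the normalization of the Beta probability density, with its constant cleared. -/
theorem lintegral_beta {a b : ℝ} (ha : 0 < a) (hb : 0 < b) :
    ∫⁻ x in Ioo (0 : ℝ) 1, ENNReal.ofReal (x ^ (a - 1) * (1 - x) ^ (b - 1)) =
      ENNReal.ofReal (beta a b) := by
  have h := ProbabilityTheory.lintegral_betaPDF_eq_one ha hb
  have hpos := beta_pos ha hb
  rw [ProbabilityTheory.lintegral_betaPDF] at h
  simp_rw [mul_assoc, ENNReal.ofReal_mul (one_div_nonneg.mpr hpos.le)] at h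
  rw [lintegral_const_mul _ (by fun_prop)] at h
  generalize ∫⁻ x in Ioo (0 : ℝ) 1, ENNReal.ofReal (x ^ (a - 1) * (1 - x) ^ (b - 1)) = I at h ⊢
  rw [← one_mul I, ← ENNReal.ofReal_one, ← mul_one_div_cancel hpos.ne',
    ENNReal.ofReal_mul hpos.le, mul_assoc, h, mul_one]

theorem lintegral_gamma {a r : ℝ} (ha : 0 < a) (hr : 0 < r) :
    ∫⁻ x in Ioi (0 : ℝ), ENNReal.ofReal (x ^ (a - 1) * Real.exp (-(r * x))) =
      ENNReal.ofReal (Real.Gamma a * r ^ (-a)) := by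
  rw [← ofReal_integral_eq_lintegral_ofReal]
  · rw [Real.integral_rpow_mul_exp_neg_mul_Ioi ha hr, one_div, Real.inv_rpow hr.le,
      Real.rpow_neg hr.le, mul_comm]
  · have := integrableOn_rpow_mul_exp_neg_mul_rpow (p := 1) (s := a - 1) (b := r)
      (by linarith) one_pos hr
    simpa [IntegrableOn] using this
  · exact (ae_restrict_mem measurableSet_Ioi).mono fun x (hx : 0 < x) => by positivity

/-- The integral of the inverse-gamma density. -/
theorem lintegral_inv_gamma {a r : ℝ} (ha : 0 < a) (hr : 0 < r) :
    ∫⁻ x in Ioi (0 : ℝ), ENNReal.ofReal (x ^ (-a - 1) * Real.exp (-(r / x))) =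
      ENNReal.ofReal (Real.Gamma a * r ^ (-a)) := by
  -- The substitution `x ↦ 1/x` reduces the claim to Euler's integral for Gamma.
  rw [← lintegral_gamma ha hr, ← lintegral_comp_rpow_Ioi _ (p := -1) (by norm_num)]
  refine setLIntegral_congr_fun measurableSet_Ioi fun x (hx : 0 < x) => ?_
  rw [← ENNReal.ofReal_mul (by positivity), ← Real.rpow_mul hx.le, abs_neg, abs_one, one_mul,
    ← mul_assoc, ← Real.rpow_add hx, Real.rpow_neg_one]
  congr 3
  · ring
  · rw [div_inv_eq_mul]

/-! ### Gauss's summation theorem -/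

theorem hasSum_of_tsum_ofReal {ι : Type*} {f : ι → ℝ} (hf : ∀ i, 0 ≤ f i) {v : ℝ} (hv : 0 ≤ v)
    (h : ∑' i, ENNReal.ofReal (f i) = ENNReal.ofReal v) : HasSum f v := by
  have := (ENNReal.hasSum_toReal (f := fun i => ENNReal.ofReal (f i)) (by rw [h]; simp))
  rwa [← ENNReal.tsum_toReal_eq (by simp), h, ENNReal.toReal_ofReal hv,
    funext fun i => ENNReal.toReal_ofReal (hf i)] at this

theorem ascPochhammer_eval_eq_Gamma_div {a : ℝ} (ha : 0 < a) (n : ℕ) :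
    (ascPochhammer ℝ n).eval a = Real.Gamma (a + n) / Real.Gamma a := by
  induction n with
  | zero => simp [(Real.Gamma_pos_of_pos ha).ne']
  | succ n ih =>
    rw [ascPochhammer_succ_eval, ih]
    push_cast
    rw [← add_assoc, Real.Gamma_add_one (by positivity : a + n ≠ 0)]
    ring

/-- Writing `Γ(a+n)` as Euler's integral and summing the exponential series `∑ (ux)^n / n!` under it
changes the decay rate from `1` to `1 - u`. -/
theorem tsum_ofReal_binomial {a u : ℝ} (ha : 0 < a) (hu : 0 < u) (hu1 : u < 1) :
    ∑' n : ℕ, ENNReal.ofReal (Real.Gamma (a + n) / n.factorial * u ^ n) =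
      ENNReal.ofReal (Real.Gamma a * (1 - u) ^ (-a)) := by
  have h1 : ∀ n : ℕ, ENNReal.ofReal (Real.Gamma (a + n) / n.factorial * u ^ n) =
      ∫⁻ x in Ioi (0 : ℝ), ENNReal.ofReal (u ^ n / n.factorial *
        (x ^ (a + n - 1) * Real.exp (-(1 * x)))) := by
    intro n
    simp_rw [fun x : ℝ => ENNReal.ofReal_mul (q := x ^ (a + n - 1) * Real.exp (-(1 * x)))
      (by positivity : 0 ≤ u ^ n / (n.factorial : ℝ))]
    rw [lintegral_const_mul _ (by fun_prop), lintegral_gamma (by positivity) one_pos,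
      ← ENNReal.ofReal_mul (by positivity)]
    congr 1
    simp
    ring
  simp_rw [h1]
  rw [← lintegral_tsum (fun n => by fun_prop), ← lintegral_gamma ha (sub_pos.mpr hu1)]
  refine setLIntegral_congr_fun measurableSet_Ioi fun x (hx : 0 < x) => ?_
  have hs : HasSum (fun n : ℕ => u ^ n / n.factorial *
        (x ^ (a + n - 1) * Real.exp (-(1 * x)))) (x ^ (a - 1) * Real.exp (-((1 - u) * x))) := by
    have := (NormedSpace.expSeries_div_hasSum_exp (u * x)).mul_right
      (x ^ (a - 1) * Real.exp (-(1 * x)))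
    rw [← Real.exp_eq_exp_ℝ] at this
    convert! this using 1
    · ext n
      rw [show a + n - 1 = a - 1 + n by ring, Real.rpow_add hx, Real.rpow_natCast]
      ring
    · rw [mul_left_comm, ← Real.exp_add]
      congr 2
      ring
  rw [← ENNReal.ofReal_tsum_of_nonneg (fun n => by positivity) hs.summable, hs.tsum_eq]

/-- Gauss's summation of `₂F₁` at `1`, for positive parameters. -/
theorem hasSum_ordinaryHypergeometricCoefficient {a b c : ℝ} (ha : 0 < a) (hb : 0 < b)
    (hcb : 0 < c - b) (hcab : 0 < c - a - b) :
    HasSum (ordinaryHypergeometricCoefficient a b c)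
      (Real.Gamma c * Real.Gamma (c - a - b) / (Real.Gamma (c - a) * Real.Gamma (c - b))) := by
  have hc : 0 < c := by linarith
  have hca : 0 < c - a := by linarith
  have Ga := Real.Gamma_pos_of_pos ha
  have Gb := Real.Gamma_pos_of_pos hb
  have Gc := Real.Gamma_pos_of_pos hc
  have Gcb := Real.Gamma_pos_of_pos hcb
  have Gca := Real.Gamma_pos_of_pos hca
  have Gcab := Real.Gamma_pos_of_pos hcab
  have hG : ∀ {x : ℝ} (_ : 0 < x) (n : ℕ), 0 < Real.Gamma (x + n) :=
    fun hx n => Real.Gamma_pos_of_pos (by positivity)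
  -- The ratio `(b)_n / (c)_n` equals `B(b+n, c-b) / B(b, c-b)`.
  have hcoef : ∀ n : ℕ, ordinaryHypergeometricCoefficient a b c n =
      Real.Gamma c / (Real.Gamma a * Real.Gamma b * Real.Gamma (c - b)) *
        (Real.Gamma (a + n) / n.factorial * beta (b + n) (c - b)) := by
    intro n
    have h1 := (hG ha n).ne'
    have h2 := (hG hb n).ne'
    have h3 := (hG hc n).ne'
    rw [ordinaryHypergeometricCoefficient, ascPochhammer_eval_eq_Gamma_div ha,
      ascPochhammer_eval_eq_Gamma_div hb, ascPochhammer_eval_eq_Gamma_div hc, beta,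
      show b + n + (c - b) = c + n by ring]
    field_simp
  refine hasSum_of_tsum_ofReal (fun n => ?_) (by positivity) ?_
  · rw [hcoef]
    have h1 := (hG ha n)
    have h2 := beta_pos (by positivity : 0 < b + n) hcb
    positivity
  set K := Real.Gamma c / (Real.Gamma a * Real.Gamma b * Real.Gamma (c - b)) with hK
  have hKpos : 0 ≤ K := by positivity
  have h1 : ∀ n : ℕ, ENNReal.ofReal (ordinaryHypergeometricCoefficient a b c n) =
      ENNReal.ofReal K * ∫⁻ u in Ioo (0 : ℝ) 1,
        ENNReal.ofReal (Real.Gamma (a + n) / n.factorial * u ^ n) *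
          ENNReal.ofReal (u ^ (b - 1) * (1 - u) ^ (c - b - 1)) := by
    intro n
    have := hG ha n
    rw [hcoef, ENNReal.ofReal_mul hKpos, ENNReal.ofReal_mul (by positivity),
      ← lintegral_beta (by positivity) hcb, ← lintegral_const_mul _ (by fun_prop)]
    congr 1
    refine setLIntegral_congr_fun measurableSet_Ioo fun u ⟨hu, hu1⟩ => ?_
    rw [← ENNReal.ofReal_mul (by positivity), ← ENNReal.ofReal_mul (by positivity),
      show b + n - 1 = b - 1 + n by ring, Real.rpow_add hu, Real.rpow_natCast]
    congr 1
    ring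
  simp_rw [h1]
  rw [ENNReal.tsum_mul_left, ← lintegral_tsum (fun n => by fun_prop)]
  -- The binomial series lowers the exponent of `1 - u` by `a`, so a single Beta integral with
  -- second parameter `c - a - b` remains.
  have h2 : ∀ u ∈ Ioo (0 : ℝ) 1, ∑' n : ℕ,
      ENNReal.ofReal (Real.Gamma (a + n) / n.factorial * u ^ n) *
          ENNReal.ofReal (u ^ (b - 1) * (1 - u) ^ (c - b - 1)) =
      ENNReal.ofReal (Real.Gamma a) *
        ENNReal.ofReal (u ^ (b - 1) * (1 - u) ^ (c - a - b - 1)) := by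
    rintro u ⟨hu, hu1⟩
    have hu2 : 0 < 1 - u := by linarith
    rw [ENNReal.tsum_mul_right, tsum_ofReal_binomial ha hu hu1, ENNReal.ofReal_mul Ga.le, mul_assoc,
      ← ENNReal.ofReal_mul (by positivity), mul_left_comm, ← Real.rpow_add hu2]
    ring_nf
  rw [setLIntegral_congr_fun measurableSet_Ioo h2, lintegral_const_mul _ (by fun_prop),
    lintegral_beta hb hcab, ← ENNReal.ofReal_mul Ga.le, ← ENNReal.ofReal_mul hKpos, hK, beta,
    show b + (c - a - b) = c - a by ring]
  congr 1
  field_simp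

/-! ### The power series of the square of a Bessel function -/

theorem ringChoose_eq_Gamma_div {x : ℝ} (hx : -1 < x) (n : ℕ) :
    Ring.choose (x + n) n = Real.Gamma (x + n + 1) / (n.factorial * Real.Gamma (x + 1)) := by
  rw [Ring.choose_eq_smul, Polynomial.descPochhammer_smeval_eq_ascPochhammer,
    show x + n - n + 1 = x + 1 by ring, Polynomial.ascPochhammer_smeval_eq_eval,
    ascPochhammer_eval_eq_Gamma_div (by linarith), smul_eq_mul,
    show x + 1 + n = x + n + 1 by ring]
  field_simp

/-- The coefficients of `J_ν²`, up to sign. -/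
noncomputable def besselSqCoeff (ν : ℝ) (k : ℕ) : ℝ :=
  Real.Gamma (2 * ν + 2 * k + 1) /
    (k.factorial * Real.Gamma (2 * ν + k + 1) * Real.Gamma (ν + k + 1) ^ 2)

theorem besselSqCoeff_pos {ν : ℝ} (hν : 0 ≤ ν) (k : ℕ) : 0 < besselSqCoeff ν k := by
  unfold besselSqCoeff
  have h1 := Real.Gamma_pos_of_pos (by positivity : 0 < 2 * ν + 2 * k + 1)
  have h2 := Real.Gamma_pos_of_pos (by positivity : 0 < 2 * ν + k + 1)
  have h3 := Real.Gamma_pos_of_pos (by positivity : 0 < ν + k + 1)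
  positivity

/-- Up to the factor `Γ(ν+k+1)²`, this is the Chu–Vandermonde identity for the generalized binomial
coefficient of `2ν + 2k` over `k`, split as `(ν+k) + (ν+k)`. -/
theorem sum_antidiagonal_inv_Gamma {ν : ℝ} (hν : 0 ≤ ν) (k : ℕ) :
    ∑ ij ∈ Finset.HasAntidiagonal.antidiagonal k,
      1 / ((ij.1.factorial : ℝ) * Real.Gamma (ij.1 + ν + 1)) *
        (1 / ((ij.2.factorial : ℝ) * Real.Gamma (ij.2 + ν + 1))) = besselSqCoeff ν k := by
  have hk := (Real.Gamma_pos_of_pos (by positivity : 0 < ν + k + 1)).ne'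
  have h1 := Ring.add_choose_eq (r := ν + k) (s := ν + k) k (Commute.all _ _)
  rw [show ν + k + (ν + k) = 2 * ν + k + k by ring,
    ringChoose_eq_Gamma_div (by linarith [(Nat.cast_nonneg k : (0 : ℝ) ≤ k)])] at h1
  have h2 : ∀ ij ∈ Finset.HasAntidiagonal.antidiagonal k,
      Ring.choose (ν + k) ij.1 * Ring.choose (ν + k) ij.2 = Real.Gamma (ν + k + 1) ^ 2 *
        (1 / ((ij.1.factorial : ℝ) * Real.Gamma (ij.1 + ν + 1)) *
        (1 / ((ij.2.factorial : ℝ) * Real.Gamma (ij.2 + ν + 1)))) := by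
    rintro ⟨i, j⟩ hij
    rw [Finset.HasAntidiagonal.mem_antidiagonal] at hij
    simp only at hij ⊢
    have hi : ν + k = ν + j + i := by rw [← hij]; push_cast; ring
    have hj : ν + k = ν + i + j := by rw [← hij]; push_cast; ring
    have ei : Ring.choose (ν + k) i = Real.Gamma (ν + k + 1) /
        (i.factorial * Real.Gamma (j + ν + 1)) := by
      rw [hi, ringChoose_eq_Gamma_div (by linarith [(Nat.cast_nonneg j : (0 : ℝ) ≤ j)]), add_comm ν]
    have ej : Ring.choose (ν + k) j = Real.Gamma (ν + k + 1) /
        (j.factorial * Real.Gamma (i + ν + 1)) := by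
      rw [hj, ringChoose_eq_Gamma_div (by linarith [(Nat.cast_nonneg i : (0 : ℝ) ≤ i)]), add_comm ν]
    rw [ei, ej]
    ring
  rw [Finset.sum_congr rfl h2, ← Finset.mul_sum] at h1
  rw [besselSqCoeff, show 2 * ν + 2 * k + 1 = 2 * ν + k + k + 1 by ring]
  rw [← div_div, h1]
  field_simp

/-- Gamma is not monotone on `[1, 2]`, but integer steps from a point at least `1` multiply it by
factors at least `1`. This lets an exponential series dominate the Bessel series. -/
theorem Gamma_le_Gamma_nat_add {ν : ℝ} (hν : 0 ≤ ν) (k : ℕ) :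
    Real.Gamma (ν + 1) ≤ Real.Gamma (k + ν + 1) := by
  induction k with
  | zero => simp
  | succ k ih =>
    refine ih.trans ?_
    have hk : (0 : ℝ) ≤ k := Nat.cast_nonneg k
    have h : 0 < Real.Gamma (k + ν + 1) := Real.Gamma_pos_of_pos (by positivity)
    rw [show ((k + 1 : ℕ) : ℝ) + ν + 1 = (k + ν + 1) + 1 by push_cast; ring,
      Real.Gamma_add_one (by positivity : (k : ℝ) + ν + 1 ≠ 0)]
    exact le_mul_of_one_le_left h.le (by linarith)

theorem summable_norm_besselJ_term {ν x : ℝ} (hν : 0 ≤ ν) (hx : 0 < x) :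
    Summable fun k : ℕ => ‖(-1 : ℝ) ^ k / ((Nat.factorial k : ℝ) * Real.Gamma (k + ν + 1)) *
      (x / 2) ^ (2 * (k : ℝ) + ν)‖ := by
  have hG := Real.Gamma_pos_of_pos (by positivity : 0 < ν + 1)
  refine Summable.of_nonneg_of_le (fun _ => norm_nonneg _) (fun k => ?_)
    ((Real.summable_pow_div_factorial ((x / 2) ^ 2)).mul_right ((x / 2) ^ ν / Real.Gamma (ν + 1)))
  have hx2 : 0 < x / 2 := by positivity
  have hk := Gamma_le_Gamma_nat_add hν k
  have hk0 := hG.trans_le hk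
  rw [Real.rpow_add hx2, norm_mul, norm_div, norm_pow, norm_neg, norm_one, one_pow,
    Real.norm_of_nonneg (by positivity), Real.norm_of_nonneg (by positivity),
    show (2 : ℝ) * k = ((2 * k : ℕ) : ℝ) by push_cast; ring, Real.rpow_natCast, pow_mul]
  calc 1 / (k.factorial * Real.Gamma (k + ν + 1)) * (((x / 2) ^ 2) ^ k * (x / 2) ^ ν)
      ≤ 1 / (k.factorial * Real.Gamma (ν + 1)) * (((x / 2) ^ 2) ^ k * (x / 2) ^ ν) := by gcongr
    _ = _ := by field_simp

theorem hasSum_besselJ_sq {ν x : ℝ} (hν : 0 ≤ ν) (hx : 0 < x) :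
    HasSum (fun k : ℕ => (-1 : ℝ) ^ k * besselSqCoeff ν k * (x / 2) ^ (2 * (k : ℝ) + 2 * ν))
      (besselJ ν x ^ 2) := by
  have hx2 : 0 < x / 2 := by positivity
  have hs := summable_norm_besselJ_term hν hx
  have h1 := tsum_mul_tsum_eq_tsum_sum_antidiagonal_of_summable_norm hs hs
  have h2 := (summable_norm_sum_mul_antidiagonal_of_summable_norm hs hs).of_norm
  rw [besselJ, sq, h1]
  convert! h2.hasSum using 1
  ext k
  rw [← sum_antidiagonal_inv_Gamma hν, Finset.mul_sum, Finset.sum_mul]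
  refine Finset.sum_congr rfl ?_
  rintro ⟨i, j⟩ hij
  rw [Finset.HasAntidiagonal.mem_antidiagonal] at hij
  simp only at hij ⊢
  rw [show 2 * (k : ℝ) + 2 * ν = (2 * i + ν) + (2 * j + ν) by rw [← hij]; push_cast; ring,
    Real.rpow_add hx2, ← hij, pow_add]
  ring

theorem aemeasurable_besselJ_sq {ν : ℝ} (hν : 0 ≤ ν) :
    AEMeasurable (fun x => besselJ ν x ^ 2) (volume.restrict (Ioi 0)) := by
  refine aemeasurable_of_tendsto_metrizable_ae' (f := fun n x => ∑ k ∈ Finset.range n,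
    (-1 : ℝ) ^ k * besselSqCoeff ν k * (x / 2) ^ (2 * (k : ℝ) + 2 * ν))
    (fun n => by fun_prop) ?_
  exact (ae_restrict_mem measurableSet_Ioi).mono fun x hx =>
    (hasSum_besselJ_sq hν hx).tendsto_sum_nat

/-! ### Termwise integration -/

/-- The terms may change sign, so the exchange rests on summability of their `L¹` norms; the result
is stated as a lower integral so that it can feed Tonelli arguments. -/
theorem lintegral_ofReal_of_hasSum {α : Type*} [MeasurableSpace α] {μ : Measure α}
    {F : ℕ → α → ℝ} {f : α → ℝ} (hF : ∀ k, Integrable (F k) μ)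
    (hsum : Summable fun k => ∫ x, ‖F k x‖ ∂μ) (hf : ∀ᵐ x ∂μ, HasSum (fun k => F k x) (f x))
    (hf0 : ∀ᵐ x ∂μ, 0 ≤ f x) :
    ∫⁻ x, ENNReal.ofReal (f x) ∂μ = ENNReal.ofReal (∑' k, ∫ x, F k x ∂μ) := by
  have hm : AEStronglyMeasurable f μ :=
    aestronglyMeasurable_of_tendsto_ae Filter.atTop
      (f := fun n x => ∑ k ∈ Finset.range n, F k x)
      (fun n => Finset.aestronglyMeasurable_fun_sum _ fun k _ => (hF k).1)
      (hf.mono fun x hx => hx.tendsto_sum_nat)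
  have hfin : ∑' k, ∫⁻ x, ‖F k x‖ₑ ∂μ ≠ ∞ := by
    have : ∀ k, ∫⁻ x, ‖F k x‖ₑ ∂μ = ENNReal.ofReal (∫ x, ‖F k x‖ ∂μ) := fun k => by
      rw [ofReal_integral_norm_eq_lintegral_enorm (hF k)]
    simp_rw [this]
    exact hsum.tsum_ofReal_ne_top
  have hint : Integrable f μ := by
    refine ⟨hm, ?_⟩
    refine lt_of_le_of_lt ?_ (lt_top_iff_ne_top.mpr hfin)
    rw [← lintegral_tsum fun k => (hF k).1.enorm]
    refine lintegral_mono_ae (hf.mono fun x hx => ?_)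
    rw [← hx.tsum_eq]
    exact enorm_tsum_le_tsum_enorm
  rw [← ofReal_integral_eq_lintegral_ofReal hint hf0,
    (hasSum_integral_of_summable_integral_norm hF hsum).tsum_eq]
  congr 1
  exact integral_congr_ae (hf.mono fun x hx => hx.tsum_eq.symm)

/-! ### The Weber–Schafheitlin integral of the square of a Bessel function -/

theorem integrableOn_beta {a b : ℝ} (ha : 0 < a) (hb : 0 < b) :
    IntegrableOn (fun x : ℝ => x ^ (a - 1) * (1 - x) ^ (b - 1)) (Ioo 0 1) := by
  refine (lintegral_ofReal_ne_top_iff_integrable (by fun_prop) ?_).mp ?_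
  · exact (ae_restrict_mem measurableSet_Ioo).mono fun x ⟨h0, h1⟩ =>
      mul_nonneg (by positivity) (Real.rpow_nonneg (by linarith) _)
  · rw [lintegral_beta ha hb]
    exact ENNReal.ofReal_ne_top

theorem integral_beta {a b : ℝ} (ha : 0 < a) (hb : 0 < b) :
    ∫ x in Ioo (0 : ℝ) 1, x ^ (a - 1) * (1 - x) ^ (b - 1) = beta a b := by
  rw [integral_eq_lintegral_of_nonneg_ae _ (by fun_prop), lintegral_beta ha hb,
    ENNReal.toReal_ofReal (beta_pos ha hb).le]
  exact (ae_restrict_mem measurableSet_Ioo).mono fun x ⟨h0, h1⟩ =>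
    mul_nonneg (by positivity) (Real.rpow_nonneg (by linarith) _)

/-- On `(0, 1)` extra powers of `x` only decrease the integrand. The bound makes the Kummer series
converge like an exponential. -/
theorem beta_nat_add_le {a b : ℝ} (ha : 0 < a) (hb : 0 < b) (k : ℕ) :
    beta (a + k) b ≤ beta a b := by
  rw [← ENNReal.ofReal_le_ofReal_iff (beta_pos ha hb).le,
    ← lintegral_beta ha hb, ← lintegral_beta (by positivity) hb]
  refine setLIntegral_mono (by fun_prop) fun x ⟨h0, h1⟩ => ENNReal.ofReal_le_ofReal ?_
  refine mul_le_mul_of_nonneg_right ?_ (Real.rpow_nonneg (by linarith) _)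
  exact Real.rpow_le_rpow_of_exponent_ge h0 h1.le (by simp)

theorem summable_pow_mul_beta {a b : ℝ} (ha : 0 < a) (hb : 0 < b) {y : ℝ} (hy : 0 ≤ y) :
    Summable fun k : ℕ => y ^ k / k.factorial * beta (a + k) b := by
  refine Summable.of_nonneg_of_le (fun k => ?_) (fun k => ?_)
    ((Real.summable_pow_div_factorial y).mul_right (beta a b))
  · have := beta_pos (by positivity : 0 < a + k) hb
    positivity
  · exact mul_le_mul_of_nonneg_left (beta_nat_add_le ha hb k) (by positivity)

/-- The power series of the Laplace transform of a Beta density (Kummer's function). -/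
theorem lintegral_beta_mul_exp {a b : ℝ} (ha : 0 < a) (hb : 0 < b) {y : ℝ} (hy : 0 < y) :
    ∫⁻ x in Ioo (0 : ℝ) 1,
      ENNReal.ofReal (x ^ (a - 1) * (1 - x) ^ (b - 1) * Real.exp (-(x * y))) =
      ENNReal.ofReal (∑' k : ℕ, (-1) ^ k * (y ^ k / k.factorial * beta (a + k) b)) := by
  have hF : ∀ k : ℕ, ∀ x ∈ Ioo (0 : ℝ) 1,
      (-1 : ℝ) ^ k * (y ^ k / k.factorial * (x ^ (a + k - 1) * (1 - x) ^ (b - 1))) =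
        x ^ (a - 1) * (1 - x) ^ (b - 1) * ((-(x * y)) ^ k / k.factorial) := by
    rintro k x ⟨h0, h1⟩
    rw [show a + k - 1 = a - 1 + k by ring, Real.rpow_add h0, Real.rpow_natCast, neg_pow (x * y),
      mul_pow]
    ring
  have hnorm : ∀ k : ℕ, ∫ x in Ioo (0 : ℝ) 1,
      ‖(-1 : ℝ) ^ k * (y ^ k / k.factorial * (x ^ (a + k - 1) * (1 - x) ^ (b - 1)))‖ =
        y ^ k / k.factorial * beta (a + k) b := by
    intro k
    rw [← integral_beta (by positivity) hb, ← integral_const_mul]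
    refine setIntegral_congr_fun measurableSet_Ioo fun x ⟨h0, h1⟩ => ?_
    have : 0 < 1 - x := by linarith
    rw [norm_mul, norm_pow, norm_neg, norm_one, one_pow, one_mul,
      Real.norm_of_nonneg (by positivity)]
  rw [lintegral_ofReal_of_hasSum (F := fun (k : ℕ) x => (-1 : ℝ) ^ k * (y ^ k / k.factorial *
    (x ^ (a + k - 1) * (1 - x) ^ (b - 1))))]
  · congr 2
    ext k
    rw [integral_const_mul, integral_const_mul, integral_beta (by positivity) hb]
  · intro k
    exact ((integrableOn_beta (by positivity) hb).const_mul _).const_mul _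
  · simp_rw [hnorm]
    exact summable_pow_mul_beta ha hb hy.le
  · refine (ae_restrict_mem measurableSet_Ioo).mono fun x hx => ?_
    simp_rw [fun k => hF k x hx]
    have := NormedSpace.expSeries_div_hasSum_exp (-(x * y))
    rw [← Real.exp_eq_exp_ℝ] at this
    exact this.mul_left _
  · refine (ae_restrict_mem measurableSet_Ioo).mono fun x ⟨h0, h1⟩ => ?_
    have : 0 < 1 - x := by linarith
    positivity

theorem besselSq_term_eq {ν y t : ℝ} (ht : 0 < t) (k : ℕ) :
    besselSqCoeff ν k * (t / 2) ^ (2 * (k : ℝ) + 2 * ν) *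
      (t ^ (2 * ν + 1) * Real.exp (-(t ^ 2 / y))) =
    besselSqCoeff ν k * 2 ^ (-(2 * (k : ℝ) + 2 * ν)) *
      (t ^ (2 * (k : ℝ) + 4 * ν + 1) * Real.exp (-y⁻¹ * t ^ (2 : ℝ))) := by
  rw [Real.div_rpow ht.le two_pos.le, Real.rpow_neg two_pos.le,
    show 2 * (k : ℝ) + 4 * ν + 1 = (2 * (k : ℝ) + 2 * ν) + (2 * ν + 1) by ring,
    Real.rpow_add ht (2 * (k : ℝ) + 2 * ν), Real.rpow_two, div_eq_mul_inv (t ^ 2), mul_comm (t ^ 2), neg_mul]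
  ring

theorem integrableOn_besselSq_term {ν y : ℝ} (hν : 0 ≤ ν) (hy : 0 < y) (k : ℕ) :
    IntegrableOn (fun t => besselSqCoeff ν k * (t / 2) ^ (2 * (k : ℝ) + 2 * ν) *
      (t ^ (2 * ν + 1) * Real.exp (-(t ^ 2 / y)))) (Ioi 0) := by
  have h := integrableOn_rpow_mul_exp_neg_mul_rpow (p := 2) (s := 2 * (k : ℝ) + 4 * ν + 1)
    (b := y⁻¹) (by linarith [(Nat.cast_nonneg k : (0 : ℝ) ≤ k)]) two_pos (by positivity)
  refine IntegrableOn.congr_fun (h.const_mul (besselSqCoeff ν k * 2 ^ (-(2 * (k : ℝ) + 2 * ν))))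
    (fun t ht => (besselSq_term_eq ht k).symm) measurableSet_Ioi

/-- The Gaussian moment produces `Γ(2ν+k+1)`, which cancels that factor of the coefficient.
Duplication at `ν + 1/2 + k` turns the remaining `Γ(2ν+2k+1) / Γ(ν+k+1)²` into `B(ν+1/2+k, 1/2) / π`
up to a power of `2`. -/
theorem integral_besselSq_term {ν y : ℝ} (hν : 0 ≤ ν) (hy : 0 < y) (k : ℕ) :
    ∫ t in Ioi (0 : ℝ), besselSqCoeff ν k * (t / 2) ^ (2 * (k : ℝ) + 2 * ν) *
      (t ^ (2 * ν + 1) * Real.exp (-(t ^ 2 / y))) =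
    y ^ (2 * ν + 1) / (2 * Real.pi) * (y ^ k / k.factorial * beta (ν + 1 / 2 + k) (1 / 2)) := by
  rw [setIntegral_congr_fun measurableSet_Ioi fun t ht => besselSq_term_eq ht k,
    integral_const_mul, integral_rpow_mul_exp_neg_mul_rpow two_pos
      (by linarith [(Nat.cast_nonneg k : (0 : ℝ) ≤ k)]) (by positivity),
    show (2 * (k : ℝ) + 4 * ν + 1 + 1) / 2 = 2 * ν + k + 1 by ring,
    show -(2 * (k : ℝ) + 4 * ν + 1 + 1) / 2 = -(2 * ν + 1 + k) by ring,
    Real.inv_rpow hy.le, ← Real.rpow_neg hy.le, neg_neg, Real.rpow_add hy, Real.rpow_natCast]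
  have h := Real.Gamma_mul_Gamma_add_half (ν + 1 / 2 + k)
  rw [show ν + 1 / 2 + k + 1 / 2 = ν + k + 1 by ring,
    show 2 * (ν + 1 / 2 + k) = 2 * ν + 2 * k + 1 by ring,
    show 1 - (2 * ν + 2 * k + 1) = -(2 * (k : ℝ) + 2 * ν) by ring] at h
  have h1 := (Real.Gamma_pos_of_pos (by positivity : 0 < 2 * ν + k + 1)).ne'
  have h2 := (Real.Gamma_pos_of_pos (by positivity : 0 < ν + k + 1)).ne'
  have h3 : Real.pi = √Real.pi * √Real.pi := (Real.mul_self_sqrt Real.pi_pos.le).symm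
  have h4 : √Real.pi ≠ 0 := by positivity
  rw [beta, Real.Gamma_one_half_eq, show ν + 1 / 2 + k + 1 / 2 = ν + k + 1 by ring, besselSqCoeff]
  generalize √Real.pi = p at *
  rw [h3]
  generalize Real.Gamma (2 * ν + 2 * k + 1) = G at *
  generalize Real.Gamma (ν + 1 / 2 + k) = H at *
  generalize Real.Gamma (ν + k + 1) = M at *
  generalize (2 : ℝ) ^ (-(2 * (k : ℝ) + 2 * ν)) = P at *
  field_simp
  linear_combination -h

/-- The Gaussian-damped integral of `J_ν²`. -/
theorem lintegral_besselJ_sq_mul_exp {ν y : ℝ} (hν : 0 ≤ ν) (hy : 0 < y) :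
    ∫⁻ t in Ioi (0 : ℝ), ENNReal.ofReal
      (besselJ ν t ^ 2 * (t ^ (2 * ν + 1) * Real.exp (-(t ^ 2 / y)))) =
    ENNReal.ofReal (y ^ (2 * ν + 1) / (2 * Real.pi)) * ∫⁻ x in Ioo (0 : ℝ) 1, ENNReal.ofReal
      (x ^ (ν + 1 / 2 - 1) * (1 - x) ^ ((1 : ℝ) / 2 - 1) * Real.exp (-(x * y))) := by
  have hnorm : ∀ k : ℕ, ∫ t in Ioi (0 : ℝ),
      ‖(-1) ^ k * (besselSqCoeff ν k * (t / 2) ^ (2 * (k : ℝ) + 2 * ν) *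
      (t ^ (2 * ν + 1) * Real.exp (-(t ^ 2 / y))))‖ =
      y ^ (2 * ν + 1) / (2 * Real.pi) *
        (y ^ k / k.factorial * beta (ν + 1 / 2 + k) (1 / 2)) := by
    intro k
    rw [← integral_besselSq_term hν hy]
    refine setIntegral_congr_fun measurableSet_Ioi fun t (ht : 0 < t) => ?_
    have := besselSqCoeff_pos hν k
    rw [norm_mul, norm_pow, norm_neg, norm_one, one_pow, one_mul,
      Real.norm_of_nonneg (by positivity)]
  rw [lintegral_beta_mul_exp (by positivity) (by norm_num) hy,
    ← ENNReal.ofReal_mul (by positivity), ← tsum_mul_left,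
    lintegral_ofReal_of_hasSum (F := fun (k : ℕ) t => (-1) ^ k * (besselSqCoeff ν k *
      (t / 2) ^ (2 * (k : ℝ) + 2 * ν) * (t ^ (2 * ν + 1) * Real.exp (-(t ^ 2 / y)))))]
  · congr 2
    ext k
    rw [integral_const_mul, integral_besselSq_term hν hy]
    ring
  · exact fun k => (integrableOn_besselSq_term hν hy k).const_mul _
  · simp_rw [hnorm]
    exact (summable_pow_mul_beta (by positivity) (by norm_num) hy.le).mul_left _
  · refine (ae_restrict_mem measurableSet_Ioi).mono fun t ht => ?_
    convert! (hasSum_besselJ_sq hν ht).mul_right (t ^ (2 * ν + 1) * Real.exp (-(t ^ 2 / y))) using 1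
    ext k
    ring
  · exact (ae_restrict_mem measurableSet_Ioi).mono fun t (ht : 0 < t) => by positivity

theorem lintegral_besselJ_sq {ν s : ℝ} (hs : 0 < s) (hsν : s < 2 * ν) :
    ∫⁻ t in Ioi (0 : ℝ), ENNReal.ofReal (besselJ ν t ^ 2 / t ^ (1 + s)) =
      ENNReal.ofReal (Real.Gamma (ν - s / 2) * beta ((s + 1) / 2) (1 / 2) /
        (2 * Real.pi * Real.Gamma (ν + 1 + s / 2))) := by
  have hν : 0 < ν := by linarith
  have ha : 0 < ν - s / 2 := by linarith
  have hb : 0 < ν + 1 + s / 2 := by linarith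
  have Ga := Real.Gamma_pos_of_pos ha
  have Gb := Real.Gamma_pos_of_pos hb
  -- The value of `b` makes `t^(-1-s) = t^(2ν+1) (t²)^(-b)`, with `Γ(b) (t²)^(-b)` an inverse-gamma
  -- integral. The Gaussian integral contributes `y^(2ν+1)`, and `a - 1` is the total exponent of
  -- `y`.
  set a := ν - s / 2 with ha_def
  set b := ν + 1 + s / 2 with hb_def
  have hβ := beta_pos (by linarith : 0 < (s + 1) / 2) (by norm_num : (0 : ℝ) < 1 / 2)
  suffices h : ENNReal.ofReal (Real.Gamma b) *
      ∫⁻ t in Ioi (0 : ℝ), ENNReal.ofReal (besselJ ν t ^ 2 / t ^ (1 + s)) =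
      ENNReal.ofReal (1 / (2 * Real.pi)) *
        ENNReal.ofReal (Real.Gamma a * beta ((s + 1) / 2) (1 / 2)) by
    rw [← ENNReal.ofReal_mul (by positivity)] at h
    rw [ENNReal.eq_div_iff (by simpa using Gb) (by simp) |>.mpr h,
      ← ENNReal.ofReal_div_of_pos Gb]
    congr 1
    field_simp
  have hJ := aemeasurable_besselJ_sq hν.le
  calc ENNReal.ofReal (Real.Gamma b) *
      ∫⁻ t in Ioi (0 : ℝ), ENNReal.ofReal (besselJ ν t ^ 2 / t ^ (1 + s))
      = ∫⁻ t in Ioi (0 : ℝ), ∫⁻ y in Ioi (0 : ℝ), ENNReal.ofReal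
          (besselJ ν t ^ 2 * t ^ (2 * ν + 1) * (y ^ (-b - 1) * Real.exp (-(t ^ 2 / y)))) := by
        rw [← lintegral_const_mul' _ _ ENNReal.ofReal_ne_top]
        refine setLIntegral_congr_fun measurableSet_Ioi fun t (ht : 0 < t) => ?_
        have h0 : 0 ≤ besselJ ν t ^ 2 * t ^ (2 * ν + 1) := by positivity
        simp_rw [ENNReal.ofReal_mul h0]
        rw [lintegral_const_mul _ (by fun_prop), lintegral_inv_gamma hb (by positivity),
          ← ENNReal.ofReal_mul h0, ← ENNReal.ofReal_mul Gb.le, ← Real.rpow_natCast t 2,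
          ← Real.rpow_mul ht.le, div_eq_mul_inv, ← Real.rpow_neg ht.le,
          show -(1 + s) = (2 * ν + 1) + ((2 : ℕ) : ℝ) * (-b) by rw [hb_def]; push_cast; ring,
          Real.rpow_add ht]
        congr 1
        ring
    _ = ∫⁻ y in Ioi (0 : ℝ), ∫⁻ t in Ioi (0 : ℝ), ENNReal.ofReal
          (besselJ ν t ^ 2 * t ^ (2 * ν + 1) * (y ^ (-b - 1) * Real.exp (-(t ^ 2 / y)))) := by
        refine lintegral_lintegral_swap (AEMeasurable.ennreal_ofReal ?_)
        have h1 : AEMeasurable (fun p : ℝ × ℝ => besselJ ν p.1 ^ 2)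
            ((volume.restrict (Ioi 0)).prod (volume.restrict (Ioi 0))) := hJ.comp_fst
        exact (h1.mul (by fun_prop)).mul (by fun_prop)
    -- The Bessel function leaves here, replaced by the Laplace transform of a Beta density at `y`.
    _ = ∫⁻ y in Ioi (0 : ℝ), ∫⁻ x in Ioo (0 : ℝ) 1, ENNReal.ofReal (1 / (2 * Real.pi)) *
          ENNReal.ofReal (x ^ (ν + 1 / 2 - 1) * (1 - x) ^ ((1 : ℝ) / 2 - 1) *
            (y ^ (a - 1) * Real.exp (-(x * y)))) := by
        refine setLIntegral_congr_fun measurableSet_Ioi fun y (hy : 0 < y) => ?_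
        have h1 : ∀ t : ℝ, ENNReal.ofReal
          (besselJ ν t ^ 2 * t ^ (2 * ν + 1) * (y ^ (-b - 1) * Real.exp (-(t ^ 2 / y)))) =
          ENNReal.ofReal (y ^ (-b - 1)) * ENNReal.ofReal
            (besselJ ν t ^ 2 * (t ^ (2 * ν + 1) * Real.exp (-(t ^ 2 / y)))) := fun t => by
          rw [← ENNReal.ofReal_mul (by positivity)]
          congr 1
          ring
        simp_rw [h1]
        rw [lintegral_const_mul' _ _ ENNReal.ofReal_ne_top, lintegral_besselJ_sq_mul_exp hν.le hy,
          ← mul_assoc, ← ENNReal.ofReal_mul (by positivity),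
          ← lintegral_const_mul' _ _ ENNReal.ofReal_ne_top]
        refine setLIntegral_congr_fun measurableSet_Ioo fun x ⟨h0, h1⟩ => ?_
        rw [← ENNReal.ofReal_mul (by positivity), ← ENNReal.ofReal_mul (by positivity),
          show a - 1 = (-b - 1) + (2 * ν + 1) by rw [ha_def, hb_def]; ring,
          Real.rpow_add hy (-b - 1)]
        congr 1
        ring
    _ = ∫⁻ x in Ioo (0 : ℝ) 1, ∫⁻ y in Ioi (0 : ℝ), ENNReal.ofReal (1 / (2 * Real.pi)) *
          ENNReal.ofReal (x ^ (ν + 1 / 2 - 1) * (1 - x) ^ ((1 : ℝ) / 2 - 1) *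
            (y ^ (a - 1) * Real.exp (-(x * y)))) :=
        lintegral_lintegral_swap (by fun_prop)
    _ = ∫⁻ x in Ioo (0 : ℝ) 1, ENNReal.ofReal (1 / (2 * Real.pi)) * (ENNReal.ofReal
          (Real.Gamma a) * ENNReal.ofReal
            (x ^ ((s + 1) / 2 - 1) * (1 - x) ^ ((1 : ℝ) / 2 - 1))) := by
        refine setLIntegral_congr_fun measurableSet_Ioo fun x ⟨h0, h1⟩ => ?_
        have h2 : 0 < 1 - x := by linarith
        have h3 : 0 ≤ x ^ (ν + 1 / 2 - 1) * (1 - x) ^ ((1 : ℝ) / 2 - 1) := by positivity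
        simp_rw [ENNReal.ofReal_mul h3]
        rw [lintegral_const_mul' _ _ ENNReal.ofReal_ne_top,
          lintegral_const_mul' _ _ ENNReal.ofReal_ne_top, lintegral_gamma ha h0,
          ← ENNReal.ofReal_mul h3, ← ENNReal.ofReal_mul Ga.le,
          show (s + 1) / 2 - 1 = (ν + 1 / 2 - 1) + -a by rw [ha_def]; ring, Real.rpow_add h0]
        congr 2
        ring
    _ = _ := by
        rw [lintegral_const_mul' _ _ ENNReal.ofReal_ne_top,
          lintegral_const_mul' _ _ ENNReal.ofReal_ne_top,
          lintegral_beta (by positivity) (by norm_num), ← ENNReal.ofReal_mul Ga.le]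

/-! ### The Riesz energy of a ball -/

/-- Polar coordinates for radial functions, in a form that does not presuppose integrability. -/
theorem lintegral_fun_norm {E : Type*} [NormedAddCommGroup E] [NormedSpace ℝ E]
    [FiniteDimensional ℝ E] [Nontrivial E] [MeasurableSpace E] [BorelSpace E] (μ : Measure E)
    [μ.IsAddHaarMeasure] {f : ℝ → ℝ≥0∞} (hf : Measurable f) :
    ∫⁻ x, f ‖x‖ ∂μ = μ.toSphere univ *
      ∫⁻ y in Ioi (0 : ℝ), ENNReal.ofReal (y ^ (Module.finrank ℝ E - 1)) * f y := by
  have hf' : Measurable fun y : Ioi (0 : ℝ) => f y := hf.comp measurable_subtype_coe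
  calc ∫⁻ x, f ‖x‖ ∂μ = ∫⁻ x : ({(0)}ᶜ : Set E), f ‖x.1‖ ∂(μ.comap (↑)) := by
        rw [lintegral_subtype_comap (measurableSet_singleton _).compl fun x ↦ f ‖x‖,
          restrict_compl_singleton]
    _ = ∫⁻ x, f x.2 ∂μ.toSphere.prod (.volumeIoiPow (Module.finrank ℝ E - 1)) := by
        have := μ.measurePreserving_homeomorphUnitSphereProd.lintegral_comp_emb
          (Homeomorph.measurableEmbedding _) (f ∘ Subtype.val ∘ Prod.snd)
        simpa using this
    _ = ∫⁻ _ : Metric.sphere (0 : E) 1, ∫⁻ y : Ioi (0 : ℝ), f y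
          ∂.volumeIoiPow (Module.finrank ℝ E - 1) ∂μ.toSphere :=
        lintegral_prod _ (hf'.comp measurable_snd).aemeasurable
    _ = _ := by
        rw [lintegral_const, mul_comm, Measure.volumeIoiPow,
          lintegral_withDensity_eq_lintegral_mul _ (by fun_prop) hf']
        congr 1
        exact lintegral_subtype_comap measurableSet_Ioi
          fun y => ENNReal.ofReal (y ^ (Module.finrank ℝ E - 1)) * f y

/-- Splitting off the first coordinate of `ℝ^(n+1)`. -/
noncomputable def splitFirst (n : ℕ) (x : EuclideanSpace ℝ (Fin (n + 1))) :
    ℝ × EuclideanSpace ℝ (Fin n) :=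
  (x 0, WithLp.toLp 2 fun i => x i.succ)

theorem measurePreserving_splitFirst (n : ℕ) : MeasurePreserving (splitFirst n) := by
  have h1 := PiLp.volume_preserving_ofLp (Fin (n + 1))
  have h2 := volume_preserving_piFinSuccAbove (fun _ : Fin (n + 1) => ℝ) 0
  have h3 := (MeasurePreserving.id (volume : Measure ℝ)).prod
    (PiLp.volume_preserving_toLp (Fin n))
  exact h3.comp (h2.comp h1)

theorem norm_add_single_sq (n : ℕ) (x : EuclideanSpace ℝ (Fin (n + 1))) (c : ℝ) :
    ‖x + EuclideanSpace.single 0 c‖ ^ 2 =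
      ((splitFirst n x).1 + c) ^ 2 + ‖(splitFirst n x).2‖ ^ 2 := by
  simp [EuclideanSpace.norm_sq_eq, Fin.sum_univ_succ, splitFirst]

/-- The `n`-dimensional volume of the slice at height `u` of a ball of radius `r` in `ℝ^(n+1)`,
relative to that of the unit ball. -/
noncomputable def sliceWeight (n : ℕ) (r u : ℝ) : ℝ≥0∞ :=
  if u < r then ENNReal.ofReal ((r ^ 2 - u ^ 2) ^ ((n : ℝ) / 2)) else 0

@[fun_prop]
theorem measurable_sliceWeight (n : ℕ) (r : ℝ) : Measurable (sliceWeight n r) :=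
  Measurable.ite measurableSet_Iio (by fun_prop) measurable_const

theorem volume_ball_slice (n : ℕ) {r u : ℝ} (hr : 0 < r) (hu : 0 ≤ u) :
    volume {y : EuclideanSpace ℝ (Fin n) | u ^ 2 + ‖y‖ ^ 2 < r ^ 2} =
      sliceWeight n r u *
        ENNReal.ofReal (Real.pi ^ ((n : ℝ) / 2) / Real.Gamma ((n : ℝ) / 2 + 1)) := by
  by_cases hur : u < r
  swap
  · have : r ^ 2 ≤ u ^ 2 := by gcongr; exact not_lt.mp hur
    have h0 : ∀ y : EuclideanSpace ℝ (Fin n), ¬ (u ^ 2 + ‖y‖ ^ 2 < r ^ 2) := fun y => by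
      nlinarith [sq_nonneg ‖y‖]
    simp [h0, sliceWeight, hur]
  have hpos : 0 < r ^ 2 - u ^ 2 := by nlinarith
  have hset : {y : EuclideanSpace ℝ (Fin n) | u ^ 2 + ‖y‖ ^ 2 < r ^ 2} =
      Metric.ball 0 √(r ^ 2 - u ^ 2) := by
    ext y
    simp only [mem_ofPred_eq, mem_ball_zero_iff]
    rw [Real.lt_sqrt (norm_nonneg _)]
    constructor <;> intro h <;> linarith
  rw [hset, sliceWeight, if_pos hur]
  -- For `n = 0` the slice is the single point of `ℝ^0`, of volume `1`; the formula for the volume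
  -- of a ball needs a nonempty index type.
  rcases n.eq_zero_or_pos with rfl | hn
  · have : (Metric.ball (0 : EuclideanSpace ℝ (Fin 0)) √(r ^ 2 - u ^ 2)) = univ :=
      eq_univ_of_forall fun y => by simp [Subsingleton.elim y 0, hpos]
    have h1 := (PiLp.volume_preserving_toLp (Fin 0)).measure_preimage (s := univ) (by simp)
    rw [preimage_univ, volume_pi, Measure.pi_of_empty, Measure.dirac_apply_of_mem
      (mem_univ _)] at h1
    simp [this, ← h1]
  · have : Nonempty (Fin n) := ⟨⟨0, hn⟩⟩
    rw [EuclideanSpace.volume_ball, Fintype.card_fin, ← ENNReal.ofReal_pow (by positivity),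
      Real.sqrt_eq_rpow, Real.sqrt_eq_rpow, ← Real.rpow_natCast (_ ^ (1 / 2 : ℝ)),
      ← Real.rpow_natCast (Real.pi ^ (1 / 2 : ℝ)),
      ← Real.rpow_mul hpos.le, ← Real.rpow_mul Real.pi_pos.le]
    ring_nf

/-- Of `|t - c|` and `|t + c|` the larger is `|t| + c`, so only the farther centre constrains the
point. -/
theorem sq_add_lt_and_iff {t c Y R : ℝ} (hc : 0 ≤ c) :
    ((t + -c) ^ 2 + Y < R ∧ (t + c) ^ 2 + Y < R) ↔ (|t| + c) ^ 2 + Y < R := by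
  rcases abs_cases t with ⟨h, h'⟩ | ⟨h, h'⟩ <;> rw [h]
  · exact ⟨fun h => h.2, fun h => ⟨by nlinarith, h⟩⟩
  · exact ⟨fun h => by nlinarith, fun h => ⟨by nlinarith, by nlinarith⟩⟩

/-- The volume of the intersection of two balls of the same radius. -/
theorem volume_lens (n : ℕ) {r : ℝ} (hr : 0 < r) (z : EuclideanSpace ℝ (Fin (n + 1))) :
    volume {y : EuclideanSpace ℝ (Fin (n + 1)) | ‖y‖ < r ∧ ‖y + z‖ < r} =
      (∫⁻ t : ℝ, sliceWeight n r (|t| + ‖z‖ / 2)) *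
        ENNReal.ofReal (Real.pi ^ ((n : ℝ) / 2) / Real.Gamma ((n : ℝ) / 2 + 1)) := by
  set c := ‖z‖ / 2 with hc
  have hc0 : 0 ≤ c := by positivity
  let e : EuclideanSpace ℝ (Fin (n + 1)) := EuclideanSpace.single 0 c
  -- `z` and `2c` times the first basis vector have the same norm, so reflection in the hyperplane
  -- orthogonal to their difference exchanges them. After a translation by `e` the two centres lie
  -- at `±c` on the first axis.
  obtain ⟨U, hU⟩ : ∃ U : EuclideanSpace ℝ (Fin (n + 1)) ≃ₗᵢ[ℝ] EuclideanSpace ℝ (Fin (n + 1)),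
      U z = e + e := by
    refine ⟨Submodule.reflection (ℝ ∙ (z - (e + e)))ᗮ, Submodule.reflection_sub ?_⟩
    rw [← two_smul ℝ, norm_smul]
    simp [e, hc]
    ring
  let S : Set (ℝ × EuclideanSpace ℝ (Fin n)) := {p | (|p.1| + c) ^ 2 + ‖p.2‖ ^ 2 < r ^ 2}
  have hS : MeasurableSet S := measurableSet_lt (by fun_prop) (by fun_prop)
  have hset : {y : EuclideanSpace ℝ (Fin (n + 1)) | ‖y‖ < r ∧ ‖y + z‖ < r} =
      U ⁻¹' ((fun y => y + e) ⁻¹' (splitFirst n ⁻¹' S)) := by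
    ext y
    have h1 : ‖y‖ = ‖(U y + e) + EuclideanSpace.single 0 (-c)‖ := by
      rw [← U.norm_map y]
      congr 1
      have : EuclideanSpace.single (0 : Fin (n + 1)) (-c) = -e := by
        ext i
        by_cases hi : i = 0 <;> simp [e, hi]
      rw [this, add_neg_cancel_right]
    have h2 : ‖y + z‖ = ‖(U y + e) + EuclideanSpace.single 0 c‖ := by
      rw [← U.norm_map, map_add, hU, add_assoc]
    simp only [mem_ofPred_eq, mem_preimage, S]
    rw [← sq_add_lt_and_iff hc0, ← norm_add_single_sq, ← norm_add_single_sq, ← h1, ← h2,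
      sq_lt_sq₀ (norm_nonneg _) hr.le, sq_lt_sq₀ (norm_nonneg _) hr.le]
  have hS' := (measurePreserving_splitFirst n).measurable hS
  rw [hset, U.measurePreserving.measure_preimage
    (measurable_add_const e hS').nullMeasurableSet,
    measure_preimage_add_right, (measurePreserving_splitFirst n).measure_preimage
      hS.nullMeasurableSet, Measure.volume_eq_prod, Measure.prod_apply hS,
    ← lintegral_mul_const _ (by fun_prop)]
  refine lintegral_congr fun t => ?_
  exact volume_ball_slice n hr (by positivity : 0 ≤ |t| + c)

theorem lintegral_sliceWeight_abs (n : ℕ) (r c : ℝ) :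
    ∫⁻ t : ℝ, sliceWeight n r (|t| + c) = 2 * ∫⁻ u in Ioi c, sliceWeight n r u := by
  have h1 : ∫⁻ t in Ioi (0 : ℝ), sliceWeight n r (|t| + c) = ∫⁻ u in Ioi c, sliceWeight n r u := by
    have := (measurePreserving_add_right (volume : Measure ℝ) c).setLIntegral_comp_preimage
      (measurableSet_Ioi (a := c)) (measurable_sliceWeight n r)
    rw [← this]
    have hp : (fun x : ℝ => x + c) ⁻¹' Ioi c = Ioi 0 := by ext; simp
    rw [hp]
    exact setLIntegral_congr_fun measurableSet_Ioi fun t (ht : 0 < t) => by rw [abs_of_pos ht]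
  have h2 : ∫⁻ t in Iic (0 : ℝ), sliceWeight n r (|t| + c) =
      ∫⁻ t in Ioi (0 : ℝ), sliceWeight n r (|t| + c) := by
    have := (Measure.measurePreserving_neg (volume : Measure ℝ)).setLIntegral_comp_preimage
      (measurableSet_Ici (a := (0 : ℝ))) (f := fun t => sliceWeight n r (|t| + c)) (by fun_prop)
    rw [← setLIntegral_congr (Ioi_ae_eq_Ici (a := (0 : ℝ)))] at this
    simpa using this
  rw [← lintegral_add_compl _ (measurableSet_Ioi (a := (0 : ℝ))), compl_Ioi, h2, h1, two_mul]

theorem lintegral_rpow_Ioo {s x : ℝ} (hs : 0 < s) (hx : 0 < x) :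
    ∫⁻ y in Ioo (0 : ℝ) x, ENNReal.ofReal (y ^ (s - 1)) = ENNReal.ofReal (x ^ s / s) := by
  have hint : IntegrableOn (fun y : ℝ => y ^ (s - 1)) (Ioc 0 x) := by
    rw [← intervalIntegrable_iff_integrableOn_Ioc_of_le hx.le]
    exact intervalIntegral.intervalIntegrable_rpow' (by linarith)
  rw [setLIntegral_congr Ioo_ae_eq_Ioc, ← ofReal_integral_eq_lintegral_ofReal hint,
    ← intervalIntegral.integral_of_le hx.le, integral_rpow (Or.inl (by linarith))]
  · simp [Real.zero_rpow hs.ne']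
  · exact (ae_restrict_mem measurableSet_Ioc).mono fun y hy => Real.rpow_nonneg hy.1.le _

theorem lintegral_sliceWeight_mul_rpow (n : ℕ) {s r : ℝ} (hs : 0 < s) (hr : 0 < r) :
    ∫⁻ u in Ioi (0 : ℝ), sliceWeight n r u * ENNReal.ofReal (u ^ s) =
      ENNReal.ofReal (r ^ (n + 1 + s) / 2 * beta ((s + 1) / 2) ((n : ℝ) / 2 + 1)) := by
  have h1 : ∫⁻ u in Ioi (0 : ℝ), sliceWeight n r u * ENNReal.ofReal (u ^ s) =
      ∫⁻ u in Ioo (0 : ℝ) r, ENNReal.ofReal ((r ^ 2 - u ^ 2) ^ ((n : ℝ) / 2) * u ^ s) := by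
    rw [← lintegral_indicator measurableSet_Ioi, ← lintegral_indicator measurableSet_Ioo]
    refine lintegral_congr fun u => ?_
    by_cases h0 : 0 < u <;> by_cases hur : u < r <;>
      simp [indicator, sliceWeight, h0, hur]
    rw [ENNReal.ofReal_mul]
    exact Real.rpow_nonneg (by nlinarith) _
  -- The substitution `u = r √v` turns the integral into Euler's Beta integral.
  have himg : (fun v : ℝ => r * v ^ (1 / 2 : ℝ)) '' Ioo 0 1 = Ioo 0 r := by
    ext u
    constructor
    · rintro ⟨v, ⟨h0, h1⟩, rfl⟩
      have : v ^ (1 / 2 : ℝ) < 1 := Real.rpow_lt_one h0.le h1 (by norm_num)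
      exact ⟨by positivity, by nlinarith⟩
    · rintro ⟨h0, h1⟩
      have hur : u / r < 1 := (div_lt_one hr).mpr h1
      refine ⟨(u / r) ^ (2 : ℝ), ⟨by positivity,
        Real.rpow_lt_one (by positivity) hur (by norm_num)⟩, ?_⟩
      simp only
      rw [← Real.rpow_mul (by positivity)]
      norm_num
      field_simp
  rw [h1, ← himg, lintegral_image_eq_lintegral_abs_deriv_mul measurableSet_Ioo
    (f' := fun v => r * (1 / 2 * v ^ ((1 : ℝ) / 2 - 1)))
    (fun v hv => ((Real.hasDerivAt_rpow_const (Or.inl hv.1.ne')).const_mul r).hasDerivWithinAt)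
    (fun v hv w hw h => (Real.rpow_left_inj hv.1.le hw.1.le (by norm_num : (1 / 2 : ℝ) ≠ 0)).mp
      (mul_left_cancel₀ hr.ne' h)), ENNReal.ofReal_mul (by positivity),
    ← lintegral_beta (by positivity) (by positivity), ← lintegral_const_mul _ (by fun_prop)]
  refine setLIntegral_congr_fun measurableSet_Ioo fun v ⟨h0, h1⟩ => ?_
  have h2 : 0 < 1 - v := by linarith
  rw [← ENNReal.ofReal_mul (by positivity), ← ENNReal.ofReal_mul (by positivity),
    abs_of_pos (by positivity)]
  congr 1
  have e1 : r ^ 2 - (r * v ^ (1 / 2 : ℝ)) ^ 2 = r ^ (2 : ℝ) * (1 - v) := by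
    rw [mul_pow, ← Real.rpow_natCast (v ^ (1 / 2 : ℝ)), ← Real.rpow_mul h0.le]
    norm_num
    ring
  rw [e1, Real.mul_rpow (by positivity) h2.le, ← Real.rpow_mul hr.le,
    Real.mul_rpow hr.le (by positivity), ← Real.rpow_mul h0.le,
    show (s + 1) / 2 - 1 = ((1 : ℝ) / 2 - 1) + 1 / 2 * s by ring, Real.rpow_add h0,
    show (n : ℝ) + 1 + s = 2 * ((n : ℝ) / 2) + 1 + s by ring, Real.rpow_add hr, Real.rpow_add hr,
    Real.rpow_one]
  ring_nf

/-- The Riesz energy of a ball of radius `r` in `ℝ^(n+1)`. -/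
theorem lintegral_ball_riesz (n : ℕ) {s r : ℝ} (hs : 0 < s) (hr : 0 < r) :
    ∫⁻ p in Metric.ball (0 : EuclideanSpace ℝ (Fin (n + 1))) r ×ˢ Metric.ball 0 r,
      ENNReal.ofReal (1 / ‖p.1 - p.2‖ ^ ((n : ℝ) + 1 - s)) ∂(volume.prod volume) =
    (volume : Measure (EuclideanSpace ℝ (Fin (n + 1)))).toSphere univ *
      ENNReal.ofReal (Real.pi ^ ((n : ℝ) / 2) / Real.Gamma ((n : ℝ) / 2 + 1) *
        (2 ^ s / s * r ^ (n + 1 + s) * beta ((s + 1) / 2) ((n : ℝ) / 2 + 1))) := by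
  set κ := Real.pi ^ ((n : ℝ) / 2) / Real.Gamma ((n : ℝ) / 2 + 1) with hκ
  have hκ0 : 0 ≤ κ := by
    have := Real.Gamma_pos_of_pos (by positivity : 0 < (n : ℝ) / 2 + 1)
    positivity
  have hsw : ∀ c : ℝ, ∫⁻ u in Ioi c, sliceWeight n r u =
      ∫⁻ u, (Ioi c).indicator (sliceWeight n r) u := fun c =>
    (lintegral_indicator measurableSet_Ioi _).symm
  have hmeas : MeasurableSet {p : ℝ × ℝ | p.1 / 2 < p.2} :=
    measurableSet_lt (by fun_prop) (by fun_prop)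
  have hind : Measurable fun p : ℝ × ℝ => (Ioi (p.1 / 2)).indicator (sliceWeight n r) p.2 := by
    have : (fun p : ℝ × ℝ => (Ioi (p.1 / 2)).indicator (sliceWeight n r) p.2) =
        {p : ℝ × ℝ | p.1 / 2 < p.2}.indicator fun p => sliceWeight n r p.2 := by
      ext p
      simp [indicator]
    rw [this]
    exact Measurable.indicator (by fun_prop) hmeas
  have hlens : Measurable fun ρ : ℝ => ∫⁻ u in Ioi (ρ / 2), sliceWeight n r u := by
    simp_rw [hsw]
    exact hind.lintegral_prod_right'
  let B : Set (EuclideanSpace ℝ (Fin (n + 1))) := Metric.ball 0 r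
  have hB : MeasurableSet B := measurableSet_ball
  let w : ℝ → ℝ≥0∞ := fun ρ => ENNReal.ofReal (1 / ρ ^ ((n : ℝ) + 1 - s))
  have hw : Measurable w := by fun_prop
  calc ∫⁻ p in B ×ˢ B, w ‖p.1 - p.2‖ ∂(volume.prod volume)
      = ∫⁻ p : EuclideanSpace ℝ (Fin (n + 1)) × EuclideanSpace ℝ (Fin (n + 1)),
          B.indicator 1 p.1 * B.indicator 1 p.2 * w ‖p.1 - p.2‖ ∂(volume.prod volume) := by
        rw [← lintegral_indicator (hB.prod hB)]
        refine lintegral_congr fun p => ?_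
        by_cases h1 : p.1 ∈ B <;> by_cases h2 : p.2 ∈ B <;> simp [indicator, h1, h2]
    _ = ∫⁻ y, ∫⁻ x, B.indicator 1 x * B.indicator 1 y * w ‖x - y‖ :=
        lintegral_prod_symm' _ (((measurable_one.indicator hB).comp measurable_fst |>.mul
          ((measurable_one.indicator hB).comp measurable_snd)).mul
            (hw.comp (by fun_prop)))
    _ = ∫⁻ y, ∫⁻ z, B.indicator 1 (y + z) * B.indicator 1 y * w ‖z‖ := by
        refine lintegral_congr fun y => ?_
        rw [← lintegral_add_left_eq_self _ y]
        simp
    _ = ∫⁻ z, ∫⁻ y, B.indicator 1 (y + z) * B.indicator 1 y * w ‖z‖ :=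
        lintegral_lintegral_swap (((measurable_one.indicator hB).comp
          (by fun_prop : Measurable fun p : EuclideanSpace ℝ (Fin (n + 1)) ×
            EuclideanSpace ℝ (Fin (n + 1)) => p.1 + p.2) |>.mul
          ((measurable_one.indicator hB).comp measurable_fst)).mul
            (hw.comp (by fun_prop))).aemeasurable
    _ = ∫⁻ z : EuclideanSpace ℝ (Fin (n + 1)), w ‖z‖ *
          (2 * (∫⁻ u in Ioi (‖z‖ / 2), sliceWeight n r u) * ENNReal.ofReal κ) := by
        refine lintegral_congr fun z => ?_
        have hm : MeasurableSet {y | ‖y‖ < r ∧ ‖y + z‖ < r} := by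
          have : {y | ‖y‖ < r ∧ ‖y + z‖ < r} = B ∩ (fun y => y + z) ⁻¹' B := by
            ext
            simp only [B, mem_inter_iff, mem_preimage, mem_ball_zero_iff, mem_ofPred_eq]
          rw [this]
          exact hB.inter (measurable_add_const z hB)
        rw [← lintegral_sliceWeight_abs, hκ, ← volume_lens n hr, ← lintegral_indicator_one hm,
          ← lintegral_const_mul' _ _ ENNReal.ofReal_ne_top]
        refine lintegral_congr fun y => ?_
        by_cases h1 : ‖y‖ < r <;> by_cases h2 : ‖y + z‖ < r <;> simp [indicator, h1, h2, B, w]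
    _ = (volume : Measure (EuclideanSpace ℝ (Fin (n + 1)))).toSphere univ *
          ∫⁻ ρ in Ioi (0 : ℝ), ENNReal.ofReal (ρ ^ n) * (w ρ *
            (2 * (∫⁻ u in Ioi (ρ / 2), sliceWeight n r u) * ENNReal.ofReal κ)) := by
        rw [lintegral_fun_norm (f := fun ρ => w ρ *
          (2 * (∫⁻ u in Ioi (ρ / 2), sliceWeight n r u) * ENNReal.ofReal κ)) volume
          (hw.mul ((hlens.const_mul _).mul_const _)), finrank_euclideanSpace, Fintype.card_fin,
          Nat.add_sub_cancel]
    _ = (volume : Measure (EuclideanSpace ℝ (Fin (n + 1)))).toSphere univ *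
          ((2 * ENNReal.ofReal κ) * ∫⁻ ρ in Ioi (0 : ℝ), ∫⁻ u in Ioi (0 : ℝ),
            ENNReal.ofReal (ρ ^ (s - 1)) * (Ioi (ρ / 2)).indicator (sliceWeight n r) u) := by
        congr 1
        rw [← lintegral_const_mul' _ _ (ENNReal.mul_ne_top (by simp) ENNReal.ofReal_ne_top)]
        refine setLIntegral_congr_fun measurableSet_Ioi fun ρ (hρ : 0 < ρ) => ?_
        rw [lintegral_const_mul' _ _ ENNReal.ofReal_ne_top,
          setLIntegral_indicator measurableSet_Ioi, Ioi_inter_Ioi,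
          max_eq_left (by positivity : 0 ≤ ρ / 2), ← mul_assoc, ← ENNReal.ofReal_mul (by positivity)]
        have : ρ ^ n * (1 / ρ ^ ((n : ℝ) + 1 - s)) = ρ ^ (s - 1) := by
          rw [one_div, ← Real.rpow_neg hρ.le, ← Real.rpow_natCast, ← Real.rpow_add hρ]
          ring_nf
        rw [this]
        ring
    -- The constraint `ρ / 2 < u` now bounds `ρ` by `2u`, and integrating `ρ^(s-1)` gives `(2u)^s /
    -- s`.
    _ = (volume : Measure (EuclideanSpace ℝ (Fin (n + 1)))).toSphere univ *
          ((2 * ENNReal.ofReal κ) * ∫⁻ u in Ioi (0 : ℝ), ∫⁻ ρ in Ioi (0 : ℝ),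
            ENNReal.ofReal (ρ ^ (s - 1)) * (Ioi (ρ / 2)).indicator (sliceWeight n r) u) := by
        rw [lintegral_lintegral_swap]
        exact (Measurable.mul (by fun_prop) hind).aemeasurable
    _ = (volume : Measure (EuclideanSpace ℝ (Fin (n + 1)))).toSphere univ *
          ((2 * ENNReal.ofReal κ) * ∫⁻ u in Ioi (0 : ℝ), ENNReal.ofReal (2 ^ s / s) *
            (sliceWeight n r u * ENNReal.ofReal (u ^ s))) := by
        congr 2
        refine setLIntegral_congr_fun measurableSet_Ioi fun u (hu : 0 < u) => ?_
        have h1 : ∀ ρ : ℝ, ENNReal.ofReal (ρ ^ (s - 1)) *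
            (Ioi (ρ / 2)).indicator (sliceWeight n r) u =
            (Iio (2 * u)).indicator (fun ρ => ENNReal.ofReal (ρ ^ (s - 1)) * sliceWeight n r u)
              ρ := fun ρ => by
          have : ρ / 2 < u ↔ ρ < 2 * u := by rw [div_lt_iff₀ two_pos, mul_comm]
          by_cases h : ρ < 2 * u <;> simp [indicator, this, h]
        simp_rw [h1]
        rw [setLIntegral_indicator measurableSet_Iio, Iio_inter_Ioi,
          lintegral_mul_const _ (by fun_prop), lintegral_rpow_Ioo hs (by positivity),
          Real.mul_rpow two_pos.le hu.le, mul_div_right_comm, ENNReal.ofReal_mul (by positivity)]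
        ring
    _ = _ := by
        rw [lintegral_const_mul' _ _ ENNReal.ofReal_ne_top, lintegral_sliceWeight_mul_rpow n hs hr,
          show 2 * ENNReal.ofReal κ = ENNReal.ofReal (2 * κ) by simp [ENNReal.ofReal_mul],
          ← ENNReal.ofReal_mul (by positivity), ← ENNReal.ofReal_mul (by positivity)]
        congr 2
        ring

/-! ### The covolume of the dual lattice -/

theorem covolume_eq_abs_det {d : ℕ} (L : Submodule ℤ (EuclideanSpace ℝ (Fin d)))
    [DiscreteTopology L] [IsZLattice ℝ L] {ι : Type*} [Fintype ι] [DecidableEq ι]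
    (b : Module.Basis ι ℝ (EuclideanSpace ℝ (Fin d)))
    (b₀ : OrthonormalBasis ι ℝ (EuclideanSpace ℝ (Fin d)))
    (hb : L = Submodule.span ℤ (Set.range b)) :
    ZLattice.covolume L volume = |b₀.toBasis.det b| := by
  subst hb
  rw [ZLattice.covolume_eq_measure_fundamentalDomain _ _ (ZSpan.isAddFundamentalDomain b volume),
    ZSpan.measureReal_fundamentalDomain _ _ b₀.toBasis,
    measureReal_congr (ZSpan.fundamentalDomain_ae_parallelepiped b₀.toBasis volume),
    OrthonormalBasis.coe_toBasis, measureReal_def, OrthonormalBasis.volume_parallelepiped,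
    ENNReal.toReal_one, mul_one]

/-- In an orthonormal basis, the transposed matrix of the dual basis times the matrix of the basis
is the identity, by Parseval; hence the two determinants are inverse to each other. -/
theorem covolume_dualLattice {d : ℕ} (Λ : Submodule ℤ (EuclideanSpace ℝ (Fin d)))
    [DiscreteTopology Λ] [IsZLattice ℝ Λ] :
    ZLattice.covolume (dualLattice Λ) volume = (ZLattice.covolume Λ volume)⁻¹ := by
  classical
  let B : LinearMap.BilinForm ℝ (EuclideanSpace ℝ (Fin d)) := innerₗ _
  have hB : B.Nondegenerate := by
    constructor
    · intro x hx
      exact inner_self_eq_zero.mp (hx x)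
    · intro x hx
      exact inner_self_eq_zero.mp (hx x)
  let b := (Module.Free.chooseBasis ℤ Λ).ofZLatticeBasis ℝ
  have hb : Λ = Submodule.span ℤ (Set.range b) :=
    ((Module.Free.chooseBasis ℤ Λ).ofZLatticeBasis_span ℝ).symm
  have hb' : dualLattice Λ = Submodule.span ℤ (Set.range (B.dualBasis hB b)) := by
    rw [← LinearMap.BilinForm.dualSubmodule_span_of_basis B hB b, ← hb]
    ext x
    rw [LinearMap.BilinForm.mem_dualSubmodule]
    refine forall₂_congr fun v _ => ?_
    rw [Submodule.mem_one]
    exact exists_congr fun n => eq_comm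
  have : DiscreteTopology (dualLattice Λ) := by rw [hb']; infer_instance
  have : IsZLattice ℝ (dualLattice Λ) :=
    ⟨by rw [hb', Submodule.span_span_of_tower]; exact (B.dualBasis hB b).span_eq⟩
  let e : Fin d ≃ Module.Free.ChooseBasisIndex ℤ Λ :=
    Fintype.equivOfCardEq (by rw [← Module.finrank_eq_card_basis b]; simp)
  let b₀ := (EuclideanSpace.basisFun (Fin d) ℝ).reindex e
  rw [covolume_eq_abs_det _ _ b₀ hb', covolume_eq_abs_det _ _ b₀ hb]
  refine eq_inv_of_mul_eq_one_left ?_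
  rw [← abs_mul, Module.Basis.det_apply, Module.Basis.det_apply, ← Matrix.det_transpose,
    ← Matrix.det_mul]
  have : (b₀.toBasis.toMatrix (B.dualBasis hB b)).transpose * b₀.toBasis.toMatrix b = 1 := by
    ext i j
    rw [Matrix.mul_apply, Matrix.one_apply]
    have h1 : inner ℝ (B.dualBasis hB b i) (b j) = if j = i then (1 : ℝ) else 0 :=
      LinearMap.BilinForm.apply_dualBasis_left hB b i j
    simp_rw [@eq_comm _ i j]
    rw [← h1, ← b₀.sum_inner_mul_inner]
    refine Finset.sum_congr rfl fun k _ => ?_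
    simp [Module.Basis.toMatrix_apply, b₀.repr_apply_apply, real_inner_comm]
  rw [this, Matrix.det_one, abs_one]

theorem nu_eq_smul {d : ℕ} (Λ : Submodule ℤ (EuclideanSpace ℝ (Fin d)))
    [DiscreteTopology Λ] [IsZLattice ℝ Λ] :
    nu Λ = ENNReal.ofReal (ZLattice.covolume Λ volume) • volume := by
  rw [nu, covolume_dualLattice, ENNReal.ofReal_inv_of_pos (ZLattice.covolume_pos Λ volume),
    inv_inv]

/-! ### Closed forms -/

theorem integrableOn_besselJ_sq {ν s : ℝ} (hs : 0 < s) (hsν : s < 2 * ν) :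
    IntegrableOn (fun t : ℝ => besselJ ν t ^ 2 / t ^ (1 + s)) (Ioi 0) := by
  refine (lintegral_ofReal_ne_top_iff_integrable ?_ ?_).mp ?_
  · exact ((aemeasurable_besselJ_sq (by linarith)).div (by fun_prop)).aestronglyMeasurable
  · exact (ae_restrict_mem measurableSet_Ioi).mono fun t (ht : 0 < t) => by positivity
  · rw [lintegral_besselJ_sq hs hsν]
    exact ENNReal.ofReal_ne_top

theorem integral_besselJ_sq {ν s : ℝ} (hs : 0 < s) (hsν : s < 2 * ν) :
    ∫ t in Ioi (0 : ℝ), besselJ ν t ^ 2 / t ^ (1 + s) =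
      Real.Gamma (ν - s / 2) * Real.Gamma ((s + 1) / 2) /
        (2 * √Real.pi * Real.Gamma (s / 2 + 1) * Real.Gamma (ν + 1 + s / 2)) := by
  have h1 := Real.Gamma_pos_of_pos (by linarith : 0 < ν - s / 2)
  have h2 := Real.Gamma_pos_of_pos (by linarith : 0 < ν + 1 + s / 2)
  have h3 := Real.Gamma_pos_of_pos (by linarith : 0 < s / 2 + 1)
  have h4 := beta_pos (by linarith : 0 < (s + 1) / 2) (by norm_num : (0 : ℝ) < 1 / 2)
  rw [integral_eq_lintegral_of_nonneg_ae _ (integrableOn_besselJ_sq hs hsν).1,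
    lintegral_besselJ_sq hs hsν, ENNReal.toReal_ofReal (by positivity), beta,
    Real.Gamma_one_half_eq, show (s + 1) / 2 + 1 / 2 = s / 2 + 1 by ring]
  · have h5 : √Real.pi * √Real.pi = Real.pi := Real.mul_self_sqrt Real.pi_pos.le
    have h6 : 0 < √Real.pi := by positivity
    generalize √Real.pi = p at *
    rw [← h5]
    field_simp
  · exact (ae_restrict_mem measurableSet_Ioi).mono fun t (ht : 0 < t) => by positivity

theorem sphereArea_pos {d : ℕ} (hd : 0 < d) : 0 < sphereArea d := by
  have := Real.Gamma_pos_of_pos (by positivity : 0 < (d : ℝ) / 2 + 1)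
  unfold sphereArea
  positivity

theorem integrableOn_ball_riesz (n : ℕ) {s r : ℝ} (hs : 0 < s) (hr : 0 < r) :
    IntegrableOn (fun p : EuclideanSpace ℝ (Fin (n + 1)) × EuclideanSpace ℝ (Fin (n + 1)) =>
      1 / ‖p.1 - p.2‖ ^ ((n : ℝ) + 1 - s)) (Metric.ball 0 r ×ˢ Metric.ball 0 r)
      (volume.prod volume) := by
  refine (lintegral_ofReal_ne_top_iff_integrable ?_ ?_).mp ?_
  · exact Measurable.aestronglyMeasurable (by fun_prop)
  · exact ae_of_all _ fun p => by positivity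
  · rw [lintegral_ball_riesz n hs hr]
    exact ENNReal.mul_ne_top (measure_ne_top _ _) ENNReal.ofReal_ne_top

theorem integral_ball_riesz (n : ℕ) {s r : ℝ} (hs : 0 < s) (hr : 0 < r) :
    ∫ p in Metric.ball (0 : EuclideanSpace ℝ (Fin (n + 1))) r ×ˢ Metric.ball 0 r,
      1 / ‖p.1 - p.2‖ ^ ((n : ℝ) + 1 - s) ∂(volume.prod volume) =
    sphereArea (n + 1) * (Real.pi ^ ((n : ℝ) / 2) * 2 ^ s * r ^ ((n : ℝ) + 1 + s) *
      Real.Gamma ((s + 1) / 2) / (s * Real.Gamma (((n : ℝ) + 1) / 2 + 1 + s / 2))) := by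
  have h1 := Real.Gamma_pos_of_pos (by positivity : 0 < (n : ℝ) / 2 + 1)
  have h2 := beta_pos (by positivity : 0 < (s + 1) / 2) (by positivity : 0 < (n : ℝ) / 2 + 1)
  rw [integral_eq_lintegral_of_nonneg_ae (ae_of_all _ fun p => by positivity)
    (integrableOn_ball_riesz n hs hr).1, lintegral_ball_riesz n hs hr, ENNReal.toReal_mul,
    ENNReal.toReal_ofReal (by positivity), sphereArea_eq_toSphere, measureReal_def, beta,
    show (s + 1) / 2 + ((n : ℝ) / 2 + 1) = ((n : ℝ) + 1) / 2 + 1 + s / 2 by ring]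
  have h3 := Real.Gamma_pos_of_pos (by positivity : 0 < ((n : ℝ) + 1) / 2 + 1 + s / 2)
  field_simp

/-- The unit ball has volume `ω/d`, and `r^d = d / (ω V)`. -/
theorem volume_real_ball_mul {d : ℕ} (hd : 0 < d) {V r : ℝ} (hV : 0 < V)
    (hr : r = (d * V⁻¹ / sphereArea d) ^ (1 / (d : ℝ))) :
    volume.real (Metric.ball (0 : EuclideanSpace ℝ (Fin d)) r) * V = 1 := by
  have hω := sphereArea_pos hd
  have hd' : (0 : ℝ) < d := by exact_mod_cast hd
  have : Nonempty (Fin d) := ⟨⟨0, hd⟩⟩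
  have h1 := sphereArea_eq_toSphere d
  rw [Measure.toSphere_real_apply_univ, finrank_euclideanSpace_fin] at h1
  have hr0 : 0 < r := by rw [hr]; positivity
  have hrd : r ^ d = d * V⁻¹ / sphereArea d := by
    rw [hr, ← Real.rpow_natCast, ← Real.rpow_mul (by positivity), one_div_mul_cancel hd'.ne',
      Real.rpow_one]
  rw [measureReal_def, Measure.addHaar_ball _ _ hr0.le, finrank_euclideanSpace_fin,
    ENNReal.toReal_mul, ENNReal.toReal_ofReal (by positivity), ← measureReal_def, hrd]
  rw [h1] at hω ⊢
  have := (pos_iff_pos_of_mul_pos hω).mp hd'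
  field_simp

theorem rieszPotential_nu {d : ℕ} (Λ : Submodule ℤ (EuclideanSpace ℝ (Fin d)))
    [DiscreteTopology Λ] [IsZLattice ℝ Λ] (D : Set (EuclideanSpace ℝ (Fin d))) (t : ℝ) :
    rieszPotential (nu Λ) D t = ZLattice.covolume Λ volume ^ 2 *
      ∫ p in D ×ˢ D, 1 / ‖p.1 - p.2‖ ^ t ∂(volume.prod volume) := by
  have hV := ZLattice.covolume_pos Λ volume
  rw [rieszPotential, nu_eq_smul, Measure.prod_smul_left, Measure.prod_smul_right, smul_smul,
    Measure.restrict_smul, integral_smul_measure, ENNReal.toReal_mul,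
    ENNReal.toReal_ofReal hV.le, smul_eq_mul, sq]

theorem integrableOn_nu_prod {d : ℕ} (Λ : Submodule ℤ (EuclideanSpace ℝ (Fin d)))
    [DiscreteTopology Λ] [IsZLattice ℝ Λ]
    {S : Set (EuclideanSpace ℝ (Fin d) × EuclideanSpace ℝ (Fin d))}
    {f : EuclideanSpace ℝ (Fin d) × EuclideanSpace ℝ (Fin d) → ℝ}
    (hf : IntegrableOn f S (volume.prod volume)) :
    IntegrableOn f S ((nu Λ).prod (nu Λ)) := by
  rw [nu_eq_smul, Measure.prod_smul_left, Measure.prod_smul_right, smul_smul, IntegrableOn,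
    Measure.restrict_smul]
  exact hf.smul_measure (ENNReal.mul_ne_top ENNReal.ofReal_ne_top ENNReal.ofReal_ne_top)

/-- Here `n + 1` is the dimension, `R` the Lebesgue energy of the ball and `B` the Bessel integral.
With `q` the radius at `V = 1`, the powers of `V` cancel, `ω q^(n+1) = n + 1` supplies the factor
`d`, and `s Γ(s/2) = 2 Γ(s/2+1)` matches the rest. -/
theorem riesz_coefficient_eq {n s V r ω R B : ℝ} (hn : 0 ≤ n) (hs : 0 < s)
    (hV : 0 < V) (hω : 0 < ω) (hr : r = ((n + 1) * V⁻¹ / ω) ^ (1 / (n + 1)))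
    (hR : R = ω * (Real.pi ^ (n / 2) * 2 ^ s * r ^ (n + 1 + s) *
      Real.Gamma ((s + 1) / 2) / (s * Real.Gamma ((n + 1) / 2 + 1 + s / 2))))
    (hB : B = Real.Gamma ((n + 1) / 2 - s / 2) * Real.Gamma ((s + 1) / 2) /
      (2 * √Real.pi * Real.Gamma (s / 2 + 1) * Real.Gamma ((n + 1) / 2 + 1 + s / 2))) :
    Real.pi ^ (s - (n + 1) / 2) * Real.Gamma (((n + 1) - s) / 2) /
        (Real.Gamma (s / 2) * V ^ (1 - s / (n + 1))) * (V ^ 2 * R) =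
      (n + 1) * (2 * Real.pi * ((n + 1) / ω) ^ (1 / (n + 1))) ^ s * B := by
  have hd : 0 < n + 1 := by positivity
  have hπ := Real.pi_pos
  set q := ((n + 1) / ω) ^ (1 / (n + 1)) with hq
  have hq0 : 0 < q := by positivity
  have hqd : ω * q ^ (n + 1) = n + 1 := by
    rw [hq, ← Real.rpow_mul (by positivity), one_div_mul_cancel hd.ne', Real.rpow_one]
    field_simp
  have hrs : r ^ (n + 1 + s) = q ^ (n + 1) * q ^ s * V ^ (-(1 + s / (n + 1))) := by
    rw [hr, show (n + 1) * V⁻¹ / ω = (n + 1) / ω * V⁻¹ by ring,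
      Real.mul_rpow (by positivity) (by positivity), ← hq,
      Real.mul_rpow (by positivity) (by positivity), Real.rpow_add hq0, Real.inv_rpow hV.le,
      ← Real.rpow_neg hV.le, ← Real.rpow_mul hV.le]
    congr 2
    field_simp
  have hVV : V ^ (1 - s / (n + 1)) = V ^ 2 * V ^ (-(1 + s / (n + 1))) := by
    rw [← Real.rpow_natCast V 2, ← Real.rpow_add hV]
    congr 1
    push_cast
    ring
  have hππ : Real.pi ^ (s - (n + 1) / 2) * Real.pi ^ (n / 2) * √Real.pi = Real.pi ^ s := by
    rw [Real.sqrt_eq_rpow, ← Real.rpow_add hπ, ← Real.rpow_add hπ]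
    congr 1
    ring
  have hG := Real.Gamma_add_one (by positivity : s / 2 ≠ 0)
  have G1 := Real.Gamma_pos_of_pos (by positivity : 0 < s / 2)
  have G2 := Real.Gamma_pos_of_pos (by positivity : 0 < (n + 1) / 2 + 1 + s / 2)
  have h5 : 0 < √Real.pi := by positivity
  have hV2 : 0 < V ^ (-(1 + s / (n + 1))) := by positivity
  rw [Real.mul_rpow (by positivity) hq0.le, Real.mul_rpow two_pos.le hπ.le, ← hππ, hR, hB, hG, hrs,
    hVV, show (n + 1) / 2 - s / 2 = (n + 1 - s) / 2 by ring]
  -- With the Gamma values and powers as atoms, a rational identity remains.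
  generalize Real.Gamma ((n + 1 - s) / 2) = g1 at *
  generalize Real.Gamma ((n + 1) / 2 + 1 + s / 2) = g2 at *
  generalize Real.Gamma ((s + 1) / 2) = g3 at *
  generalize Real.Gamma (s / 2) = g4 at *
  generalize V ^ (-(1 + s / (n + 1))) = v at *
  generalize q ^ s = qs at *
  generalize hQ : q ^ (n + 1) = Q at *
  generalize Real.pi ^ (s - (n + 1) / 2) = p1 at *
  generalize Real.pi ^ (n / 2) = p2 at *
  generalize (2 : ℝ) ^ s = t at *
  generalize √Real.pi = p at *
  rw [show p1 * g1 / (g4 * (V ^ 2 * v)) *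
      (V ^ 2 * (ω * (p2 * t * (Q * qs * v) * g3 / (s * g2)))) =
      (ω * Q) * (p1 * g1 / (g4 * (V ^ 2 * v)) *
      (V ^ 2 * ((p2 * t * (qs * v) * g3 / (s * g2))))) by ring, hqd]
  field_simp

/-- Duplication at `(d+1)/2` trades `√π` for `Γ(d+1)`, `Γ(d/2+1)` and `Γ((d+1)/2)`. -/
theorem gauss_coefficient_eq {d s : ℝ} (hd : 0 < d) (hs : 0 < s) (hsd : s < d) :
    Real.Gamma ((d - s) / 2) * Real.Gamma ((s + 1) / 2) /
      (2 * √Real.pi * Real.Gamma (s / 2 + 1) * Real.Gamma ((d + s) / 2 + 1)) =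
    Real.Gamma ((d - s) / 2) * Real.Gamma (d + 1) * Real.Gamma ((s + 1) / 2) /
        (2 ^ (d + 1) * Real.Gamma (d / 2 + 1) * Real.Gamma (s / 2 + 1) *
          Real.Gamma ((d + s) / 2 + 1) * Real.Gamma ((d + 1) / 2)) := by
  have h := Real.Gamma_mul_Gamma_add_half ((d + 1) / 2)
  rw [show (d + 1) / 2 + 1 / 2 = d / 2 + 1 by ring, show 2 * ((d + 1) / 2) = d + 1 by ring,
    show 1 - (d + 1) = -d by ring, Real.rpow_neg two_pos.le] at h
  have G1 := Real.Gamma_pos_of_pos (by positivity : 0 < s / 2 + 1)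
  have G2 := Real.Gamma_pos_of_pos (by positivity : 0 < (d + s) / 2 + 1)
  have G3 := Real.Gamma_pos_of_pos (by positivity : 0 < d / 2 + 1)
  have G4 := Real.Gamma_pos_of_pos (by positivity : 0 < (d + 1) / 2)
  have G5 := Real.Gamma_pos_of_pos (by positivity : 0 < d + 1)
  have G6 := Real.Gamma_pos_of_pos (by linarith : 0 < (d - s) / 2)
  have h5 : 0 < √Real.pi := by positivity
  have h2 : (0 : ℝ) < 2 ^ d := by positivity
  rw [Real.rpow_add two_pos, Real.rpow_one]
  field_simp at h ⊢
  linear_combination h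

end RieszTorus

theorem mainTheorem4 (d : ℕ) (s : ℝ) (hs : 0 < s) (hsd : s < d)
    (Λ : Submodule ℤ (EuclideanSpace ℝ (Fin d))) [DiscreteTopology Λ] [IsZLattice ℝ Λ]
    (r : ℝ)
    (hr : r = (d * (ZLattice.covolume Λ volume)⁻¹ / RieszTorus.sphereArea d) ^ (1 / (d : ℝ)))
    (D : Set (EuclideanSpace ℝ (Fin d))) (hD : D = Metric.ball 0 r) :
    volume.real D * ZLattice.covolume Λ volume = 1 ∧
    -- both integrals and the hypergeometric series at `1` converge (absolutely)
    IntegrableOn (fun p : EuclideanSpace ℝ (Fin d) × EuclideanSpace ℝ (Fin d) =>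
        1 / ‖p.1 - p.2‖ ^ ((d : ℝ) - s)) (D ×ˢ D)
      ((RieszTorus.nu Λ).prod (RieszTorus.nu Λ)) ∧
    IntegrableOn (fun t : ℝ => RieszTorus.besselJ ((d : ℝ) / 2) t ^ 2 / t ^ (1 + s)) (Ioi 0) ∧
    Summable (ordinaryHypergeometricCoefficient
      (((d : ℝ) - s) / 2) (((d : ℝ) + 1) / 2) ((d : ℝ) + 1)) ∧
    -- the coefficient in terms of the Bessel integral
    Real.pi ^ (s - (d : ℝ) / 2) * Real.Gamma (((d : ℝ) - s) / 2) /
          (Real.Gamma (s / 2) * ZLattice.covolume Λ volume ^ (1 - s / (d : ℝ))) *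
        RieszTorus.rieszPotential (RieszTorus.nu Λ) D ((d : ℝ) - s) =
      d * (2 * Real.pi * ((d : ℝ) / RieszTorus.sphereArea d) ^ (1 / (d : ℝ))) ^ s *
        ∫ t in Ioi (0 : ℝ), RieszTorus.besselJ ((d : ℝ) / 2) t ^ 2 / t ^ (1 + s) ∧
    -- the Bessel integral in terms of `₂F₁` at `1`
    (∫ t in Ioi (0 : ℝ), RieszTorus.besselJ ((d : ℝ) / 2) t ^ 2 / t ^ (1 + s)) =
      Real.Gamma (((d : ℝ) - s) / 2) /
          (2 ^ (d + 1) * Real.Gamma ((d : ℝ) / 2 + 1) * Real.Gamma (s / 2 + 1)) *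
        ordinaryHypergeometric (((d : ℝ) - s) / 2) (((d : ℝ) + 1) / 2) ((d : ℝ) + 1) (1 : ℝ) ∧
    -- its closed form
    (∫ t in Ioi (0 : ℝ), RieszTorus.besselJ ((d : ℝ) / 2) t ^ 2 / t ^ (1 + s)) =
      Real.Gamma (((d : ℝ) - s) / 2) * Real.Gamma ((d : ℝ) + 1) * Real.Gamma ((s + 1) / 2) /
        (2 ^ (d + 1) * Real.Gamma ((d : ℝ) / 2 + 1) * Real.Gamma (s / 2 + 1) *
          Real.Gamma (((d : ℝ) + s) / 2 + 1) * Real.Gamma (((d : ℝ) + 1) / 2)) := by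
  subst hD
  have hd : 0 < d := by
    have : (0 : ℝ) < d := hs.trans hsd
    exact_mod_cast this
  -- The energy computation slices `ℝ^(n+1)` into copies of `ℝ^n`.
  obtain ⟨n, rfl⟩ := Nat.exists_eq_succ_of_ne_zero hd.ne'
  have hV := ZLattice.covolume_pos Λ volume
  have hω := RieszTorus.sphereArea_pos hd
  have hcast : ((n.succ : ℕ) : ℝ) = n + 1 := by push_cast; rfl
  have hr0 : 0 < r := by
    rw [hr]
    positivity
  have hB := RieszTorus.integral_besselJ_sq (ν := (n.succ : ℝ) / 2) hs (by linarith)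
  -- Here `c - a - b = (s+1)/2`, so Gauss's convergence condition holds.
  have hgauss := RieszTorus.hasSum_ordinaryHypergeometricCoefficient
    (a := ((n.succ : ℝ) - s) / 2) (b := ((n.succ : ℝ) + 1) / 2) (c := (n.succ : ℝ) + 1)
    (by linarith) (by positivity) (by linarith) (by linarith)
  have hclosed := RieszTorus.gauss_coefficient_eq (d := (n.succ : ℝ)) (by positivity) hs hsd
  have hB' : (∫ t in Ioi (0 : ℝ), RieszTorus.besselJ ((n.succ : ℝ) / 2) t ^ 2 / t ^ (1 + s)) =
      Real.Gamma (((n.succ : ℝ) - s) / 2) * Real.Gamma ((n.succ : ℝ) + 1) *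
        Real.Gamma ((s + 1) / 2) /
        (2 ^ (n.succ + 1) * Real.Gamma ((n.succ : ℝ) / 2 + 1) * Real.Gamma (s / 2 + 1) *
          Real.Gamma (((n.succ : ℝ) + s) / 2 + 1) * Real.Gamma (((n.succ : ℝ) + 1) / 2)) := by
    rw [hB, ← Real.rpow_natCast 2 (n.succ + 1), Nat.cast_add_one n.succ, ← hclosed]
    ring_nf
  refine ⟨RieszTorus.volume_real_ball_mul hd hV hr, ?_,
    RieszTorus.integrableOn_besselJ_sq hs (by linarith), hgauss.summable, ?_, ?_, hB'⟩
  · have := RieszTorus.integrableOn_nu_prod Λ (RieszTorus.integrableOn_ball_riesz n hs hr0)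
    rw [hcast]
    exact this
  · rw [RieszTorus.rieszPotential_nu]
    have hR := RieszTorus.integral_ball_riesz n hs hr0
    rw [hcast] at hr hsd hB ⊢
    exact RieszTorus.riesz_coefficient_eq (Nat.cast_nonneg n) hs hV hω hr hR hB
  · rw [hB', ordinaryHypergeometric_eq_tsum]
    have h1 := hgauss.tsum_eq
    simp only [ordinaryHypergeometricCoefficient] at h1
    simp only [one_pow, smul_eq_mul, mul_one]
    rw [h1, show (n.succ : ℝ) + 1 - (n.succ - s) / 2 - (n.succ + 1) / 2 = (s + 1) / 2 by ring,
      show (n.succ : ℝ) + 1 - (n.succ - s) / 2 = (n.succ + s) / 2 + 1 by ring,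
      show (n.succ : ℝ) + 1 - (n.succ + 1) / 2 = (n.succ + 1) / 2 by ring]
    ring
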